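/- Fix $d\ge 3$. A bubble is a finite connected bipartite graph (black and white vertices) whose edges carry colours in $\{1,\dots,d\}$, each colour being incident exactly once to each vertex. For $C\subset\{1,\dots,d\}$, a $C$-bidipole insertion replaces a vertex $u$ by three vertices $v,\bar v,w$ ($v,w$ of the type of $u$, $\bar v$ of the other type), where $\bar v$ is joined to $w$ by the edges with colours in $C$ and to $v$ by those with colours in $\widehat C=\{1,\dots,d\}\setminus C$, and $v$ (resp. $w$) receives the former edges of $u$ with colours in $C$ (resp. $\widehat C$). As $C$ and $\widehat C$ give the same move, $C$ is taken admissible: $C\ne\emptyset$, $|C|\le d/2$, and $1\in C$ if $|C|=d/2$. Generalized melonic (GM) bubbles are those obtained from the two-vertex bubble by bidipole insertions; those obtained with $|C|=1$ only (equivalently by insertions of melonic dipoles on edges) are the melonic ones. Let $(B_r)_{r\in R}$ be a finite family of GM bubbles; let $V_r$ be the number of vertices of $B_r$, and $b^{(r)}_C$ the number of $C$-bidipole insertions in a construction of $B_r$. Let $\mathbb G(\{b_r,B_r\})$ be the set of connected graphs obtained from $b_r$ copies of $B_r$, $r\in R$, by adding a perfect matching of white with black vertices, whose edges have colour $0$.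 For real scaling coefficients $(s_r)$ put $\delta(G)=\sum_{c=1}^d L_{0c}(G)+\sum_r s_r b_r$, where $L_{0c}(G)$ is the number of bicoloured cycles with colours $\{0,c\}$. Let $\mathbb G_{\max}(\{b_r,B_r\})$ be the set of graphs maximizing $\delta$ in $\mathbb G(\{b_r,B_r\})$. A large-$N$ limit exists if $\delta$ is bounded above over all graphs and all $\{b_r\}$; it is non-trivial if moreover, for every $r$, there are graphs with arbitrarily large $b_r$ for which $\delta$ reaches its maximum over all graphs and all $\{b_r\}$ (leading-order graphs). (1) There is a non-trivial large-$N$ limit if and only if, for all $r\in R$, $$ s_r = s_r^*:=\sum_C |C|\, b_C^{(r)}-\frac{d(V_r-2)}{2}. $$ In particular $s_r^*=-\frac{(d-1)(V_r-2)}{2}$ if $B_r$ is melonic, and $s_r^*>-\frac{(d-1)(V_r-2)}{2}$ otherwise. (2) With $s_r=s_r^*$, the leading-order graphs with $b_r$ bubbles $B_r$ are exactly those in $\mathbb G_{\max}(\{b_r,B_r\})$, for all $\{b_r\}$. (3) Let $Q_C$ be the quartic bubble: two white and two black vertices on a cycle whose edges are alternately multiplied by the colours in $C$ and in $\widehat C$.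 For each $r$, let $H_r$ be a connected graph made of quartic bubbles (with admissible $C$) and dashed lines, each joining a white and a black vertex, with at most one dashed line at each vertex, such that cutting any dashed line disconnects $H_r$ and such that contracting all dashed lines of $H_r$ (deleting the two ends and reconnecting their edges colour by colour) gives $\partial H_r=B_r$. Let $\mathbb G(\{b_r,H_r\})$ be the set of connected graphs obtained from $b_r$ copies of $H_r$ by adding dashed lines so that each vertex is incident to exactly one, all dashed lines being given colour $0$. Let $S:\mathbb G(\{b_r,H_r\})\to\mathbb G(\{b_r,B_r\})$ replace each copy of $H_r$ by $\partial H_r=B_r$. With $s_r=s_r^*$, let $\mathbb G_{\max}(\{b_r,H_r\})$ be the set of $G\in \mathbb G(\{b_r,H_r\})$ with $\delta(G)=\sum_{c}L_{0c}(G)+\sum_r s_r b_r=d$. Then for all $\{b_r\}$ $$\mathbb G_{\max}(\{b_r,B_r\})=S\bigl(\mathbb G_{\max}(\{b_r,H_r\})\bigr),\qquad \mathbb G_{\max}(\{b_r,H_r\})\subset \mathbb G_{\max}\Bigl(\Bigl\{\sum_r b^{(r)}_C b_r,\,Q_C\Bigr\}\Bigr).$$ -/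

import Mathlib

/-! ## Edge-coloured bipartite graphs -/

/-- A finite bipartite graph with white vertices `W`, black vertices `K`, whose edges carry colours
in `ι`, every colour being incident exactly once to every vertex: the edges of colour `c` form a
perfect matching `edge c` between white and black vertices. -/
structure ColoredGraph (ι : Type) where
  W : Type
  K : Type
  [finW : Finite W]
  [finK : Finite K]
  edge : ι → (W ≃ K)

namespace ColoredGraph

attribute [instance] ColoredGraph.finW ColoredGraph.finK

variable {ι : Type}

/-- The subgraph on all vertices formed by the edges with colours in `S`
(multiple edges are irrelevant for connectivity). -/
def colorSubgraph (X : ColoredGraph ι) (S : Set ι) : SimpleGraph (X.W ⊕ X.K) :=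
  SimpleGraph.fromRel fun a b => ∃ c ∈ S, ∃ w : X.W, a = Sum.inl w ∧ b = Sum.inr (X.edge c w)

/-- Connectedness (in particular the graph is not empty). -/
def Connected (X : ColoredGraph ι) : Prop :=
  (X.colorSubgraph Set.univ).Connected

/-- The number of bicoloured cycles with colours `i ≠ j`: the subgraph with colours `{i, j}` is
2-regular, so its cycles are its connected components (a double edge is a cycle of length 2). -/
noncomputable def numCycles (X : ColoredGraph ι) (i j : ι) : ℕ :=
  Nat.card (X.colorSubgraph {i, j}).ConnectedComponent

/-- The number of vertices, white and black. -/
noncomputable def numVertices (X : ColoredGraph ι) : ℕ :=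
  Nat.card X.W + Nat.card X.K

/-- Isomorphisms preserve the colours of vertices and edges. -/
structure Iso (X Y : ColoredGraph ι) where
  onW : X.W ≃ Y.W
  onK : X.K ≃ Y.K
  comm : ∀ (c : ι) (w : X.W), onK (X.edge c w) = Y.edge c (onW w)

/-- Disjoint union of a finite family of coloured graphs. -/
def disjUnion {I : Type} [Finite I] (X : I → ColoredGraph ι) : ColoredGraph ι where
  W := Σ i, (X i).W
  K := Σ i, (X i).K
  edge c := Equiv.sigmaCongrRight fun i => (X i).edge c

/-- The graph with two vertices joined by one edge of every colour. -/
def twoVertex (ι : Type) : ColoredGraph ι where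
  W := Unit
  K := Unit
  edge _ := Equiv.refl _

/-- Add a perfect matching `σ` (the edges of the fictitious colour `0`) to a graph with `d` colours;
the old colour `c : Fin d` becomes `c.succ`. -/
def addZero {d : ℕ} (X : ColoredGraph (Fin d)) (σ : X.W ≃ X.K) : ColoredGraph (Fin (d + 1)) where
  W := X.W
  K := X.K
  edge := Fin.cons (α := fun _ => X.W ≃ X.K) σ X.edge

/-- `∑_{c=1}^d L_{0c}`, the total number of bicoloured cycles with colours `{0, c}`. -/
noncomputable def totalCycles {d : ℕ} (X : ColoredGraph (Fin (d + 1))) : ℕ :=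
  ∑ c : Fin d, X.numCycles 0 c.succ

variable {d : ℕ}

open Classical in
/-- Insertion of a `C`-bidipole at the white vertex `u`. The new black vertex is `none : Option X.K`.
The two white vertices replacing `u` are `none`, which is joined to the new black vertex by the
colours outside `C` and receives the former edges of `u` with colours in `C`, and `some u`, which is
joined to the new black vertex by the colours in `C` and keeps the other edges of `u`. -/
noncomputable def insertWhite (X : ColoredGraph (Fin d)) (C : Finset (Fin d)) (u : X.W) :
    ColoredGraph (Fin d) where
  W := Option X.W
  K := Option X.K
  edge c :=
    if c ∈ C then (Equiv.swap (some u) none).trans (Equiv.optionCongr (X.edge c))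
    else Equiv.optionCongr (X.edge c)

open Classical in
/-- Insertion of a `C`-bidipole at the black vertex `u` (colours of vertices exchanged). -/
noncomputable def insertBlack (X : ColoredGraph (Fin d)) (C : Finset (Fin d)) (u : X.K) :
    ColoredGraph (Fin d) where
  W := Option X.W
  K := Option X.K
  edge c :=
    if c ∈ C then (Equiv.optionCongr (X.edge c)).trans (Equiv.swap (some u) none)
    else Equiv.optionCongr (X.edge c)

open Classical in
/-- Insertion of a melonic dipole on the edge of colour `c` at the white vertex `u`: the new vertices
`none`, `none` are joined by the `d - 1` colours other than `c`, and the edge from `u` to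
`X.edge c u` is replaced by an edge of colour `c` from `u` to the new black vertex and one from the
new white vertex to `X.edge c u`. -/
noncomputable def insertDipole (X : ColoredGraph (Fin d)) (c : Fin d) (u : X.W) :
    ColoredGraph (Fin d) where
  W := Option X.W
  K := Option X.K
  edge c' :=
    if c' = c then (Equiv.swap (some u) none).trans (Equiv.optionCongr (X.edge c'))
    else Equiv.optionCongr (X.edge c')

/-- The quartic bubble `Q_C`: four vertices on a cycle whose edges are alternately multiplied by the
colours in `C` and by those outside `C`. -/
def quartic (C : Finset (Fin d)) : ColoredGraph (Fin d) where
  W := Fin 2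
  K := Fin 2
  edge c := if c ∈ C then Equiv.swap 0 1 else Equiv.refl _

end ColoredGraph

/-! ## Generalized melonic bubbles -/

/-- Admissible colour sets: the chosen representative of `{C, Cᶜ}`, with `|C| ≤ d/2` and, if
`|C| = d/2`, containing the first colour. (`C = ∅` would produce disconnected graphs.) -/
def AdmissibleSet {d : ℕ} (C : Finset (Fin d)) : Prop :=
  C.Nonempty ∧ 2 * C.card ≤ d ∧ (2 * C.card = d → ∃ c ∈ C, (c : ℕ) = 0)

/-- `GMBuild B m`: the bubble `B` is obtained (up to isomorphism) from the two-vertex bubble by a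
sequence of bidipole insertions whose multiset of colour sets is `m`. Since `C`-bidipoles and
`Cᶜ`-bidipoles are the same thing, each insertion is recorded by its admissible colour set. -/
inductive GMBuild {d : ℕ} : ColoredGraph (Fin d) → Multiset (Finset (Fin d)) → Prop
  | two : GMBuild (ColoredGraph.twoVertex (Fin d)) 0
  | white {B : ColoredGraph (Fin d)} {m : Multiset (Finset (Fin d))} (h : GMBuild B m)
      (C : Finset (Fin d)) (hC : AdmissibleSet C) (u : B.W) : GMBuild (B.insertWhite C u) (C ::ₘ m)
  | black {B : ColoredGraph (Fin d)} {m : Multiset (Finset (Fin d))} (h : GMBuild B m)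
      (C : Finset (Fin d)) (hC : AdmissibleSet C) (u : B.K) : GMBuild (B.insertBlack C u) (C ::ₘ m)
  | iso {B B' : ColoredGraph (Fin d)} {m : Multiset (Finset (Fin d))} (h : GMBuild B m)
      (e : B.Iso B') : GMBuild B' m

/-- Melonic bubbles: obtained from the two-vertex bubble by melonic dipole insertions. -/
inductive IsMelonic {d : ℕ} : ColoredGraph (Fin d) → Prop
  | two : IsMelonic (ColoredGraph.twoVertex (Fin d))
  | dipole {B : ColoredGraph (Fin d)} (h : IsMelonic B) (c : Fin d) (u : B.W) :
      IsMelonic (B.insertDipole c u)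
  | iso {B B' : ColoredGraph (Fin d)} (h : IsMelonic B) (e : B.Iso B') : IsMelonic B'

/-! ## Feynman graphs of the model with interactions `B r`, `r : R` -/

section Feynman

variable {d : ℕ} {R : Type} [Fintype R]

/-- The disjoint union of `b r` copies of `B r` for all `r`. -/
def copies {ι : Type} (B : R → ColoredGraph ι) (b : R → ℕ) : ColoredGraph ι :=
  ColoredGraph.disjUnion fun p : (Σ r, Fin (b r)) => B p.1

/-- Wick contractions: perfect matchings between the white and the black vertices. -/
abbrev Wick (B : R → ColoredGraph (Fin d)) (b : R → ℕ) : Type :=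
  (copies B b).W ≃ (copies B b).K

/-- The graph with colours `{0, 1, …, d}` defined by a Wick contraction. -/
def Wick.graph {B : R → ColoredGraph (Fin d)} {b : R → ℕ} (σ : Wick B b) :
    ColoredGraph (Fin (d + 1)) :=
  (copies B b).addZero σ

/-- `𝔾({b_r, B_r})`: the connected graphs obtained by Wick contractions. -/
def feynmanGraphs (B : R → ColoredGraph (Fin d)) (b : R → ℕ) : Set (Wick B b) :=
  {σ | σ.graph.Connected}

/-- The exponent `δ = ∑_c L_{0c} + ∑_r s_r b_r` of `N` in the amplitude of a graph. -/
noncomputable def amplitudeDegree (s : R → ℝ) (b : R → ℕ) (X : ColoredGraph (Fin (d + 1))) : ℝ :=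
  (X.totalCycles : ℝ) + ∑ r, s r * (b r : ℝ)

/-- `𝔾_max({b_r, B_r})`: the graphs maximizing the number of bicoloured cycles
(equivalently, the degree) at fixed numbers of bubbles. -/
def maxGraphs (B : R → ColoredGraph (Fin d)) (b : R → ℕ) : Set (Wick B b) :=
  {σ ∈ feynmanGraphs B b | ∀ τ ∈ feynmanGraphs B b, τ.graph.totalCycles ≤ σ.graph.totalCycles}

/-- A large-`N` limit exists: the degree is bounded independently of the numbers of bubbles. -/
def HasLargeNLimit (B : R → ColoredGraph (Fin d)) (s : R → ℝ) : Prop :=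
  ∃ q : ℝ, ∀ (b : R → ℕ), ∀ σ ∈ feynmanGraphs B b, amplitudeDegree s b σ.graph ≤ q

/-- The graphs with `b r` bubbles `B r` that contribute at leading order at large `N`: those whose
degree is the maximum over all Feynman graphs with arbitrary numbers of bubbles. -/
def leadingGraphs (B : R → ColoredGraph (Fin d)) (s : R → ℝ) (b : R → ℕ) : Set (Wick B b) :=
  {σ ∈ feynmanGraphs B b | ∀ (b' : R → ℕ), ∀ τ ∈ feynmanGraphs B b',
    amplitudeDegree s b' τ.graph ≤ amplitudeDegree s b σ.graph}

/-- A non-trivial large-`N` limit: it exists and, for every `r`, leading-order graphs exist with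
arbitrarily many bubbles `B r`. -/
def HasNontrivialLargeNLimit (B : R → ColoredGraph (Fin d)) (s : R → ℝ) : Prop :=
  HasLargeNLimit B s ∧ ∀ (r : R) (n : ℕ), ∃ b : R → ℕ, n ≤ b r ∧ (leadingGraphs B s b).Nonempty

end Feynman

/-! ## Dashed lines, their contraction, and trees of quartic bubbles -/

/-- Dashed lines on a coloured graph: each one joins a white and a black vertex, and every vertex is
incident to at most one of them. -/
structure Dashing {d : ℕ} (X : ColoredGraph (Fin d)) where
  lines : List (X.W × X.K)
  nodup_fst : (lines.map Prod.fst).Nodup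
  nodup_snd : (lines.map Prod.snd).Nodup

open Classical in
/-- Effect on the edges of a given colour of the contraction of the dashed line `{w, k}`: the
neighbour of `k` becomes joined to the neighbour `e w` of `w`. The vertices `w` and `k`, now joined
to each other only, are deleted in `Dashing.boundary`. -/
noncomputable def contractLine {W K : Type} (e : W ≃ K) (p : W × K) : W ≃ K :=
  e.trans (Equiv.swap p.2 (e p.1))

/-- Successive contraction of a list of dashed lines. -/
noncomputable def contractLines {W K : Type} (e : W ≃ K) (l : List (W × K)) : W ≃ K :=
  l.foldl contractLine e

theorem contractLines_of_avoid {W K : Type} {w : W} {k : K} :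
    ∀ (l : List (W × K)) (e : W ≃ K), e w = k → w ∉ l.map Prod.fst → k ∉ l.map Prod.snd →
      contractLines e l w = k
  | [], _, h, _, _ => h
  | p :: l, e, h, hw, hk => by
    simp only [List.map_cons, List.mem_cons, not_or] at hw hk
    refine contractLines_of_avoid l (contractLine e p) ?_ hw.2 hk.2
    have h1 : e w ≠ e p.1 := fun h' => hw.1 (e.injective h')
    rw [h] at h1
    unfold contractLine
    rw [Equiv.trans_apply, h]
    exact @Equiv.swap_apply_of_ne_of_ne _ (_) _ _ _ hk.1 h1

theorem contractLines_of_mem {W K : Type} {w : W} {k : K} :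
    ∀ (l : List (W × K)) (e : W ≃ K), (l.map Prod.fst).Nodup → (l.map Prod.snd).Nodup →
      (w, k) ∈ l → contractLines e l w = k
  | [], _, _, _, h => by simp at h
  | p :: l, e, h1, h2, h => by
    simp only [List.map_cons, List.nodup_cons] at h1 h2
    rcases List.mem_cons.1 h with rfl | h
    · refine contractLines_of_avoid l _ ?_ h1.1 h2.1
      simp [contractLine]
    · exact contractLines_of_mem l (contractLine e p) h1.2 h2.2 h

theorem contractLines_free {W K : Type} (l : List (W × K)) (e : W ≃ K)
    (h1 : (l.map Prod.fst).Nodup) (h2 : (l.map Prod.snd).Nodup) (w : W) :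
    w ∉ l.map Prod.fst ↔ contractLines e l w ∉ l.map Prod.snd := by
  rw [not_iff_not]
  constructor
  · intro h
    obtain ⟨⟨w', k⟩, hp, rfl⟩ := List.mem_map.1 h
    rw [contractLines_of_mem l e h1 h2 hp]
    exact List.mem_map.2 ⟨_, hp, rfl⟩
  · intro h
    obtain ⟨⟨w', k⟩, hp, hk⟩ := List.mem_map.1 h
    have h3 := contractLines_of_mem l e h1 h2 hp
    have h4 : w = w' := (contractLines e l).injective (by rw [h3]; exact hk.symm)
    subst h4
    exact List.mem_map.2 ⟨_, hp, rfl⟩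

namespace Dashing

variable {d : ℕ} {X : ColoredGraph (Fin d)}

/-- White vertices with no incident dashed line. -/
abbrev FreeW (D : Dashing X) : Type := {w : X.W // w ∉ D.lines.map Prod.fst}

/-- Black vertices with no incident dashed line. -/
abbrev FreeK (D : Dashing X) : Type := {k : X.K // k ∉ D.lines.map Prod.snd}

/-- The boundary `∂`: the contraction of all dashed lines. -/
noncomputable def boundary (D : Dashing X) : ColoredGraph (Fin d) where
  W := D.FreeW
  K := D.FreeK
  edge c := (contractLines (X.edge c) D.lines).subtypeEquiv
    (contractLines_free D.lines (X.edge c) D.nodup_fst D.nodup_snd)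

end Dashing

/-- The graph formed by all the coloured edges of `X` and a set `L` of dashed lines. -/
def ColoredGraph.withLines {d : ℕ} (X : ColoredGraph (Fin d)) (L : Set (X.W × X.K)) :
    SimpleGraph (X.W ⊕ X.K) :=
  X.colorSubgraph Set.univ ⊔
    SimpleGraph.fromRel fun a b => ∃ p ∈ L, a = Sum.inl p.1 ∧ b = Sum.inr p.2

/-- Elements of `⋃_V 𝔾_V`: connected graphs made of quartic bubbles and dashed lines, such that
cutting any dashed line disconnects the graph. -/
structure QuarticTree (d : ℕ) where
  /-- the set of quartic bubbles -/
  I : Type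
  [finI : Finite I]
  /-- the colour sets of the quartic bubbles -/
  colorSet : I → Finset (Fin d)
  admissible : ∀ i, AdmissibleSet (colorSet i)
  dash : Dashing (ColoredGraph.disjUnion fun i => ColoredGraph.quartic (colorSet i))
  connected : (ColoredGraph.withLines _ {p | p ∈ dash.lines}).Connected
  isCut : ∀ p ∈ dash.lines,
    ¬ (ColoredGraph.withLines _ {q | q ∈ dash.lines ∧ q ≠ p}).Connected

namespace QuarticTree

attribute [instance] QuarticTree.finI

/-- The underlying disjoint union of quartic bubbles. -/
def graph {d : ℕ} (H : QuarticTree d) : ColoredGraph (Fin d) :=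
  ColoredGraph.disjUnion fun i => ColoredGraph.quartic (H.colorSet i)

/-- The boundary bubble `∂H`; its vertices are those of `H` with no incident dashed line. -/
noncomputable def boundary {d : ℕ} (H : QuarticTree d) : ColoredGraph (Fin d) :=
  H.dash.boundary

end QuarticTree

/-! ## Feynman graphs built from trees of quartic bubbles, and the map `S` -/

section TreeGraphs

variable {d : ℕ} {R : Type} [Fintype R]

/-- `b r` copies of `H r` for all `r`, connected by additional dashed lines so that each vertex is
incident to exactly one dashed line: `zero` is the matching formed by all the dashed lines, including
those of the copies of the `H r`. -/
structure TreeWick (H : R → QuarticTree d) (b : R → ℕ) where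
  zero : Wick (fun r => (H r).graph) b
  internal : ∀ (p : Σ r, Fin (b r)) (w : (H p.1).graph.W) (k : (H p.1).graph.K),
    (w, k) ∈ (H p.1).dash.lines → zero ⟨p, w⟩ = ⟨p, k⟩

/-- A family of subtypes and the subtype of the disjoint union. -/
def sigmaSubtype {I : Type} {A : I → Type} (P : ∀ i, A i → Prop) :
    (Σ i, {a : A i // P i a}) ≃ {x : Σ i, A i // P x.1 x.2} where
  toFun x := ⟨⟨x.1, x.2.1⟩, x.2.2⟩
  invFun x := ⟨x.1.1, ⟨x.1.2, x.2⟩⟩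
  left_inv _ := rfl
  right_inv _ := rfl

namespace TreeWick

variable {H : R → QuarticTree d} {b : R → ℕ}

/-- The graph with colours `{0, 1, …, d}`, all dashed lines having colour `0`. -/
def graph (G : TreeWick H b) : ColoredGraph (Fin (d + 1)) :=
  Wick.graph G.zero

/-- Vertices with no incident dashed line in their copy of some `H r`. -/
def IsFreeW (x : (copies (fun r => (H r).graph) b).W) : Prop :=
  x.2 ∉ (H x.1.1).dash.lines.map Prod.fst

/-- Vertices with no incident dashed line in their copy of some `H r`. -/
def IsFreeK (x : (copies (fun r => (H r).graph) b).K) : Prop :=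
  x.2 ∉ (H x.1.1).dash.lines.map Prod.snd

theorem isFree_iff (G : TreeWick H b) (x : (copies (fun r => (H r).graph) b).W) :
    IsFreeW x ↔ IsFreeK (G.zero x) := by
  unfold IsFreeW IsFreeK
  rw [not_iff_not]
  constructor
  · intro h
    obtain ⟨p, w⟩ := x
    obtain ⟨⟨w', k⟩, hp, hw⟩ := List.mem_map.1 h
    cases hw
    rw [G.internal p _ k hp]
    exact List.mem_map.2 ⟨_, hp, rfl⟩
  · intro h
    obtain ⟨y, hy⟩ : ∃ y, G.zero x = y := ⟨_, rfl⟩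
    rw [hy] at h
    obtain ⟨p, k⟩ := y
    obtain ⟨⟨w, k'⟩, hp, hk⟩ := List.mem_map.1 h
    cases hk
    have hx : x = ⟨p, w⟩ := G.zero.injective (hy.trans (G.internal p w _ hp).symm)
    subst hx
    exact List.mem_map.2 ⟨_, hp, rfl⟩

/-- The additional dashed lines, as a perfect matching of the vertices of the copies of the
boundary bubbles `∂H r`: apply `∂` to every copy of the `H r`. -/
def contract (G : TreeWick H b) : Wick (fun r => (H r).boundary) b :=
  (sigmaSubtype fun (p : Σ r, Fin (b r)) (w : (H p.1).graph.W) =>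
      w ∉ (H p.1).dash.lines.map Prod.fst).trans <|
    (G.zero.subtypeEquiv G.isFree_iff).trans
      (sigmaSubtype fun (p : Σ r, Fin (b r)) (k : (H p.1).graph.K) =>
        k ∉ (H p.1).dash.lines.map Prod.snd).symm

end TreeWick

/-- `𝔾({b_r, H_r})`: the connected graphs among them. -/
def treeGraphs (H : R → QuarticTree d) (b : R → ℕ) : Set (TreeWick H b) :=
  {G | G.graph.Connected}

/-- `𝔾_max({b_r, H_r})`: the graphs of `𝔾({b_r, H_r})` with degree `d`. -/
def maxTreeGraphs (H : R → QuarticTree d) (s : R → ℝ) (b : R → ℕ) : Set (TreeWick H b) :=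
  {G ∈ treeGraphs H b | amplitudeDegree s b G.graph = d}

/-- The map `S`: replace every copy of `H r` by `∂H r = B r`, where the vertices of `H r` with no
incident dashed line are identified with the vertices of `B r` by `φ r`. -/
def boundaryMap {H : R → QuarticTree d} {B : R → ColoredGraph (Fin d)}
    (φ : ∀ r, (H r).boundary.Iso (B r)) {b : R → ℕ} (G : TreeWick H b) : Wick B b :=
  (Equiv.sigmaCongrRight fun p : (Σ r, Fin (b r)) => (φ p.1).onW).symm.trans
    (G.contract.trans (Equiv.sigmaCongrRight fun p : (Σ r, Fin (b r)) => (φ p.1).onK))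

end TreeGraphs

/-! ## The quartic model and the critical scaling -/

/-- The interactions of the quartic model: all `Q_C` with `C` admissible. -/
def quarticFamily (d : ℕ) : {C : Finset (Fin d) // AdmissibleSet C} → ColoredGraph (Fin d) :=
  fun C => ColoredGraph.quartic C.1

noncomputable instance instFintypeAdmissible (d : ℕ) : Fintype {C : Finset (Fin d) // AdmissibleSet C} :=
  Fintype.ofFinite _

/-- `∑_C |C| b_C - d (V - 2) / 2`, where `b_C` is the multiplicity of `C` in `m` and `V` is the
number of vertices of `B`. -/
noncomputable def scalingCoefficient {d : ℕ} (B : ColoredGraph (Fin d))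
    (m : Multiset (Finset (Fin d))) : ℝ :=
  (∑ C : Finset (Fin d), (C.card : ℝ) * (m.count C : ℝ)) - (d : ℝ) * ((B.numVertices : ℝ) - 2) / 2

/-! ## Equivalence relations and cycles of permutations -/

/-! Everything reduces to counting orbits of permutations of the white vertices. A bidipole
insertion with colour set `C` multiplies the matchings with colours in `C` by one transposition, so
a bubble built with the multiset `m` has matchings `e c = E ∘ f c`, where `f c` is a product of
`card m` factors, each a transposition for the colours of its set and trivial otherwise
(`GMBuild.exists_swapGen`). After adding the matching `σ` of colour 0, `L_{0c}` is the number of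
orbits of `π * f c`, with `π = σ⁻¹ ∘ E`.

A transposition changes an orbit number by at most one, and lowers it by exactly one when it joins
two orbits. For the upper bound, keep a partition containing the orbits of all the `π * f c`. A
factor inside a class adds at most `|C| ≤ d - |C|` orbits, while a factor merging two classes
removes exactly `|C|` orbits and one class. A connected graph ends with a single class, so at `s =
s*` its degree is at most `d`. For the lower bound, take for `π` a single cycle through one vertex
of each bubble, all other vertices being fixed. The value `d` is thus reached for every nonzero `b`,
which gives (2). For (1), a coefficient above `s_r*` makes the degree unbounded, and one below it
makes graphs with many bubbles `B r` subdominant.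

For (3), contracting a bridge of colour 0 preserves the numbers of cycles once its two ends are
deleted, and also preserves connectedness, so `boundaryMap` preserves the degree; it is onto. It
remains to see that `H r` contains exactly the quartic bubbles recorded by `m r`. For a set `S` of
colours, a bubble has `1 + #{C ∈ m : S ⊆ C or S ∩ C = ∅}` components with colours in `S`. Bridge
contraction makes these numbers comparable for `H r` and `B r`, and Möbius inversion over `S`
recovers the multiset (`eq_of_countP_noncrossing_eq`). -/

theorem eqvGen_setoid_le {α : Type*} {R : α → α → Prop} {s : Setoid α}
    (h : ∀ x y, R x y → s x y) : Relation.EqvGen.setoid R ≤ s := by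
  intro x y hxy
  induction hxy with
  | rel x y h' => exact h x y h'
  | refl x => exact s.refl x
  | symm x y _ ih => exact s.symm ih
  | trans x y z _ _ ih1 ih2 => exact s.trans ih1 ih2

namespace Setoid

/-- The equivalence relation obtained from `r` by merging the classes of `a` and `b`. -/
def glue {α : Type*} (r : Setoid α) (a b : α) : Setoid α where
  r x y := r x y ∨ (r x a ∨ r x b) ∧ (r y a ∨ r y b)
  iseqv := by
    refine ⟨fun x => Or.inl (r.refl x), ?_, ?_⟩
    · rintro x y (h | h)
      · exact Or.inl (r.symm h)
      · exact Or.inr h.symm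
    · rintro x y z (h | h) (h' | h')
      · exact Or.inl (r.trans h h')
      · exact Or.inr ⟨h'.1.imp (r.trans h) (r.trans h), h'.2⟩
      · exact Or.inr ⟨h.1, h.2.imp (r.trans (r.symm h')) (r.trans (r.symm h'))⟩
      · exact Or.inr ⟨h.1, h'.2⟩

variable {α : Type*} {r s : Setoid α} {a b : α}

theorem le_glue : r ≤ r.glue a b := fun _ _ h => Or.inl h

theorem glue_pair : r.glue a b a b := Or.inr ⟨Or.inl (r.refl a), Or.inr (r.refl b)⟩

theorem glue_le (h : r ≤ s) (hab : s a b) : r.glue a b ≤ s := by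
  rintro x y (h' | ⟨h1, h2⟩)
  · exact h h'
  · have key : ∀ z, r z a ∨ r z b → s z a := by
      rintro z (hz | hz)
      · exact h hz
      · exact s.trans (h hz) (s.symm hab)
    exact s.trans (key x h1) (s.symm (key y h2))

theorem glue_eq_of_rel (h : r a b) : r.glue a b = r := le_antisymm (glue_le le_rfl h) le_glue

/-- The classes of `r` biject with `Option` of the glued classes: the class of `b` goes to `none`,
and the class of `a` stands for the merged class. -/
theorem card_quotient_eq_card_glue_add_one [Finite α] (h : ¬ r a b) :
    Nat.card (Quotient r) = Nat.card (Quotient (r.glue a b)) + 1 := by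
  classical
  rw [← Finite.card_option]
  refine Nat.card_congr (Equiv.ofBijective
    (Quotient.lift (fun x => if r x b then none else some (Quotient.mk (r.glue a b) x)) ?_) ⟨?_, ?_⟩)
  · intro x y hxy
    by_cases hx : r x b
    · have hy : r y b := r.trans (r.symm hxy) hx
      simp [hx, hy]
    · have hy : ¬ r y b := fun hy => hx (r.trans hxy hy)
      simp only [hx, hy, if_false, Option.some.injEq]
      exact Quotient.sound (s := r.glue a b) (le_glue hxy)
  · intro x y
    induction x using Quotient.inductionOn with | _ x
    induction y using Quotient.inductionOn with | _ y
    intro hxy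
    apply Quotient.sound
    simp only [Quotient.lift_mk] at hxy
    by_cases hx : r x b <;> by_cases hy : r y b
    · exact r.trans hx (r.symm hy)
    · simp [hx, hy] at hxy
    · simp [hx, hy] at hxy
    · simp only [hx, hy, if_false, Option.some.injEq] at hxy
      rcases Quotient.exact hxy with h' | ⟨h1 | h1, h2 | h2⟩
      · exact h'
      · exact r.trans h1 (r.symm h2)
      · exact absurd h2 hy
      · exact absurd h1 hx
      · exact absurd h1 hx
  · rintro (_ | x)
    · exact ⟨Quotient.mk r b, by simp⟩
    · induction x using Quotient.inductionOn with | _ x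
      by_cases hx : r x b
      · refine ⟨Quotient.mk r a, ?_⟩
        simp only [Quotient.lift_mk, h, if_false, Option.some.injEq]
        exact Quotient.sound (s := r.glue a b) (Or.inr ⟨Or.inl (r.refl a), Or.inr hx⟩)
      · exact ⟨Quotient.mk r x, by simp [hx]⟩

theorem card_quotient_anti [Finite α] (h : r ≤ s) :
    Nat.card (Quotient s) ≤ Nat.card (Quotient r) :=
  Nat.card_le_card_of_surjective (Quotient.map' id fun _ _ h' => h h') fun y => by
    induction y using Quotient.inductionOn with | _ y
    exact ⟨Quotient.mk r y, rfl⟩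

theorem card_quotient_le_card_glue_add_one [Finite α] (r : Setoid α) (a b : α) :
    Nat.card (Quotient r) ≤ Nat.card (Quotient (r.glue a b)) + 1 := by
  by_cases h : r a b
  · rw [glue_eq_of_rel h]; omega
  · exact (card_quotient_eq_card_glue_add_one h).le

theorem card_quotient_eq_one_iff [Finite α] :
    Nat.card (Quotient r) = 1 ↔ Nonempty α ∧ ∀ x y, r x y := by
  rw [Nat.card_eq_one_iff_unique]
  constructor
  · rintro ⟨h1, ⟨q⟩⟩
    induction q using Quotient.inductionOn with | _ q
    exact ⟨⟨q⟩, fun x y => Quotient.exact (h1.elim (Quotient.mk r x) (Quotient.mk r y))⟩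
  · rintro ⟨⟨x⟩, h⟩
    refine ⟨⟨fun p q => ?_⟩, ⟨Quotient.mk r x⟩⟩
    induction p using Quotient.inductionOn with | _ p
    induction q using Quotient.inductionOn with | _ q
    exact Quotient.sound (h p q)

end Setoid

/-! ### Orbits of a permutation multiplied by a transposition. -/

namespace Equiv.Perm

variable {α : Type*}

/-- The number of cycles of a permutation, fixed points included. -/
noncomputable def numOrbits (f : Perm α) : ℕ := Nat.card (Quotient (SameCycle.setoid f))

theorem sameCycle_setoid_le {f : Perm α} {r : Setoid α} (h : ∀ x, r x (f x)) :
    SameCycle.setoid f ≤ r := by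
  have hn : ∀ (n : ℕ) x, r x ((f ^ n) x) := by
    intro n
    induction n with
    | zero => exact fun x => r.refl x
    | succ n ih => exact fun x => by rw [pow_succ']; exact r.trans (ih x) (h _)
  rintro x y ⟨i, rfl⟩
  obtain ⟨n, rfl | rfl⟩ := i.eq_nat_or_neg
  · exact hn n x
  · have := hn n ((f ^ (-(n : ℤ))) x)
    rw [← zpow_natCast, ← mul_apply, ← zpow_add, add_neg_cancel, zpow_zero, one_apply] at this
    exact r.symm this

/-- A cycle with `w` removed is still a path from `f w` to `f⁻¹ w`, and each of its steps avoids
`w`. Serves both for joining two cycles by a transposition and for contracting a line. -/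
theorem rel_apply_symm_apply_of_rel_off [Finite α] {f : Perm α} {r : Setoid α} {w : α} (hw : f w ≠ w)
    (h : ∀ x, SameCycle f w x → x ≠ w → f x ≠ w → r x (f x)) : r (f w) (f.symm w) := by
  have hper : w ∈ Function.periodicPts f :=
    Function.mem_periodicPts.2 ⟨orderOf f, orderOf_pos f, by
      rw [Function.IsPeriodicPt, Function.IsFixedPt, ← coe_pow, pow_orderOf_eq_one]; rfl⟩
  have hpos := Function.minimalPeriod_pos_of_mem_periodicPts hper
  have hne : ∀ j, 0 < j → j < Function.minimalPeriod f w → (f ^ j) w ≠ w := by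
    intro j h0 h1 h2
    rw [coe_pow] at h2
    exact Function.not_isPeriodicPt_of_pos_of_lt_minimalPeriod h0.ne' h1 h2
  have key : ∀ j, j + 1 < Function.minimalPeriod f w → r (f w) ((f ^ (j + 1)) w) := by
    intro j
    induction j with
    | zero => intro _; simp
    | succ j ih =>
      intro hj
      refine r.trans (ih (by omega)) ?_
      have h1 : (f ^ (j + 1 + 1)) w = f ((f ^ (j + 1)) w) := by rw [pow_succ']; rfl
      rw [h1]
      refine h _ ⟨(j + 1 : ℕ), by rw [zpow_natCast]⟩ (hne _ (by omega) (by omega)) ?_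
      rw [← h1]
      exact hne _ (by omega) hj
  obtain ⟨j, hj⟩ : ∃ j, Function.minimalPeriod f w = j + 2 := by
    refine ⟨Function.minimalPeriod f w - 2, ?_⟩
    have : Function.minimalPeriod f w ≠ 1 := fun h1 =>
      hw (Function.minimalPeriod_eq_one_iff_isFixedPt.1 h1)
    omega
  have h3 := key j (by omega)
  convert h3 using 1
  rw [Equiv.symm_apply_eq]
  have h4 : (f ^ (j + 2)) w = w := by
    rw [coe_pow, ← hj]; exact Function.isPeriodicPt_minimalPeriod f w
  rw [pow_succ' f (j + 1)] at h4
  exact h4.symm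

/-- The transposition only exchanges the images of `a` and `b`, which is invisible once their
classes are merged. One inclusion suffices, since multiplying by the swap is an involution. -/
theorem sameCycle_setoid_glue_swap [DecidableEq α] (f : Perm α) (a b : α) :
    (SameCycle.setoid (f * swap a b)).glue a b = (SameCycle.setoid f).glue a b := by
  have key : ∀ f : Perm α,
      (SameCycle.setoid (f * swap a b)).glue a b ≤ (SameCycle.setoid f).glue a b := by
    intro f
    refine Setoid.glue_le (sameCycle_setoid_le fun x => ?_) Setoid.glue_pair
    have hs : (SameCycle.setoid f).glue a b x (swap a b x) := by
      by_cases ha : x = a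
      · subst ha; rw [swap_apply_left]; exact Setoid.glue_pair
      · by_cases hb : x = b
        · subst hb; rw [swap_apply_right]; exact Setoid.symm' _ Setoid.glue_pair
        · rw [swap_apply_of_ne_of_ne ha hb]
    exact Setoid.trans' _ hs (Setoid.le_glue (sameCycle_apply_right.2 (SameCycle.refl f _)))
  refine le_antisymm (key f) ?_
  simpa [mul_assoc] using key (f * swap a b)

theorem numOrbits_le_numOrbits_mul_swap [DecidableEq α] [Finite α] (f : Perm α) (a b : α) :
    f.numOrbits ≤ (f * swap a b).numOrbits + 1 := by
  refine (Setoid.card_quotient_le_card_glue_add_one (SameCycle.setoid f) a b).trans ?_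
  rw [← sameCycle_setoid_glue_swap]
  exact Nat.add_le_add_right (Setoid.card_quotient_anti Setoid.le_glue) 1

theorem numOrbits_mul_swap_le [DecidableEq α] [Finite α] (f : Perm α) (a b : α) :
    (f * swap a b).numOrbits ≤ f.numOrbits + 1 := by
  simpa [mul_assoc] using numOrbits_le_numOrbits_mul_swap (f * swap a b) a b

/-- From `a` the product jumps to `f b`, then follows the old cycle of `b`, which does not contain
`a`, until it reaches `b`. -/
theorem sameCycle_mul_swap_of_not_sameCycle [DecidableEq α] [Finite α] {f : Perm α} {a b : α}
    (h : ¬ SameCycle f a b) : SameCycle (f * swap a b) a b := by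
  have ha : (f * swap a b) a = f b := by simp
  by_cases hb : f b = b
  · exact ⟨1, by rw [zpow_one, ha, hb]⟩
  have h1 : SameCycle (f * swap a b) (f b) (f.symm b) := by
    refine rel_apply_symm_apply_of_rel_off (r := SameCycle.setoid (f * swap a b)) hb ?_
    intro x hx hxb _
    have hxa : x ≠ a := by rintro rfl; exact h hx.symm
    exact ⟨1, by simp [swap_apply_of_ne_of_ne hxa hxb]⟩
  have h2 : SameCycle (f * swap a b) (f.symm b) b := by
    refine ⟨1, ?_⟩
    have hxb : f.symm b ≠ b := fun h' => hb (by rw [Equiv.symm_apply_eq] at h'; exact h'.symm)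
    have hxa : f.symm b ≠ a := by
      intro h'
      exact h ⟨1, by simp [← h']⟩
    simp [swap_apply_of_ne_of_ne hxa hxb]
  exact SameCycle.trans ⟨1, by simp⟩ (h1.trans h2)

/-- Both permutations have the same glued partition. Gluing costs one class for `f` and none for the
product, where `a` and `b` are already in one cycle. -/
theorem numOrbits_mul_swap_of_not_sameCycle [DecidableEq α] [Finite α] {f : Perm α} {a b : α}
    (h : ¬ SameCycle f a b) : f.numOrbits = (f * swap a b).numOrbits + 1 := by
  unfold numOrbits
  rw [Setoid.card_quotient_eq_card_glue_add_one (r := SameCycle.setoid f) h,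
    ← sameCycle_setoid_glue_swap,
    Setoid.glue_eq_of_rel (r := SameCycle.setoid (f * swap a b)) (sameCycle_mul_swap_of_not_sameCycle h)]

theorem numOrbits_conj {β : Type*} (f : Perm α) (g : Perm β) (e : α ≃ β)
    (h : ∀ x, e (f x) = g (e x)) : f.numOrbits = g.numOrbits := by
  refine Nat.card_congr (Quotient.congr e fun x y => ?_)
  have hg : g = e.permCongr f := by ext x; simp [permCongr_apply, h]
  subst hg
  change SameCycle f x y ↔ SameCycle (e.permCongr f) (e x) (e y)
  have hz : ∀ i : ℤ, (e.permCongr f) ^ i = e.permCongr (f ^ i) := fun i =>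
    (map_zpow e.permCongrHom f i).symm
  constructor
  · rintro ⟨i, rfl⟩; exact ⟨i, by rw [hz]; simp [permCongr_apply]⟩
  · rintro ⟨i, hi⟩
    refine ⟨i, ?_⟩
    rw [hz] at hi
    simpa [permCongr_apply] using hi

end Equiv.Perm

/-! ## Components of a family of matchings -/

/-- The relation on the white vertices generated by the paths of length two with colours in `S`. -/
def colorSetoid {ι W K : Type} (e : ι → W ≃ K) (S : Set ι) : Setoid W :=
  Relation.EqvGen.setoid fun x y => ∃ c ∈ S, ∃ c' ∈ S, e c x = e c' y

/-- The number of components of the subgraph with colours in `S` (for nonempty `S`). -/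
noncomputable def numComponents {ι W K : Type} (e : ι → W ≃ K) (S : Set ι) : ℕ :=
  Nat.card (Quotient (colorSetoid e S))

section

variable {ι W K : Type} {e : ι → W ≃ K} {S : Set ι}

theorem colorSetoid_of_eq {x y : W} {c c' : ι} (hc : c ∈ S) (hc' : c' ∈ S)
    (h : e c x = e c' y) : colorSetoid e S x y :=
  Relation.EqvGen.rel _ _ ⟨c, hc, c', hc', h⟩

theorem colorSetoid_le {r : Setoid W}
    (h : ∀ c ∈ S, ∀ c' ∈ S, ∀ x y, e c x = e c' y → r x y) : colorSetoid e S ≤ r :=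
  eqvGen_setoid_le fun x y ⟨c, hc, c', hc', h'⟩ => h c hc c' hc' x y h'

theorem colorSetoid_mono {T : Set ι} (h : S ⊆ T) : colorSetoid e S ≤ colorSetoid e T :=
  colorSetoid_le fun _ hc _ hc' _ _ h' => colorSetoid_of_eq (h hc) (h hc') h'

/-- This turns bicoloured cycles into orbits: a walk of length two between white vertices is
trivial, a step of the permutation, or the reverse of such a step. -/
theorem colorSetoid_pair (i j : ι) :
    colorSetoid e {i, j} = Equiv.Perm.SameCycle.setoid ((e j).trans (e i).symm) := by
  apply le_antisymm
  · refine colorSetoid_le ?_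
    have h1 : ∀ x y, e j x = e i y →
        Equiv.Perm.SameCycle.setoid ((e j).trans (e i).symm) x y := fun x y h =>
      ⟨1, by simp [h]⟩
    rintro c (rfl | rfl) c' (rfl | rfl) x y h
    · rw [(e c').injective h]
    · exact Setoid.symm' _ (h1 y x h.symm)
    · exact h1 x y h
    · rw [(e c').injective h]
  · exact Equiv.Perm.sameCycle_setoid_le fun x =>
      colorSetoid_of_eq (c := j) (c' := i) (by simp) (by simp) (by simp)

theorem numComponents_pair (i j : ι) :
    numComponents e {i, j} = Equiv.Perm.numOrbits ((e j).trans (e i).symm) := by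
  unfold numComponents Equiv.Perm.numOrbits
  rw [colorSetoid_pair]

theorem colorSetoid_congr {W' K' : Type} {e' : ι → W' ≃ K'} (f : W ≃ W') (g : K ≃ K')
    (h : ∀ c ∈ S, ∀ x, g (e c x) = e' c (f x)) (x y : W) :
    colorSetoid e S x y ↔ colorSetoid e' S (f x) (f y) := by
  constructor
  · intro hxy
    refine (colorSetoid_le (r := (colorSetoid e' S).comap f) ?_) hxy
    intro c hc c' hc' x y hx
    exact colorSetoid_of_eq hc hc' (by rw [← h c hc, ← h c' hc', hx])
  · intro hxy
    have := (colorSetoid_le (r := (colorSetoid e S).comap f.symm) ?_) hxy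
    · simpa [Setoid.comap_rel] using this
    intro c hc c' hc' x y hx
    refine colorSetoid_of_eq hc hc' (g.injective ?_)
    rw [h c hc, h c' hc', f.apply_symm_apply, f.apply_symm_apply, hx]

theorem numComponents_congr {W' K' : Type} {e' : ι → W' ≃ K'} (f : W ≃ W') (g : K ≃ K')
    (h : ∀ c ∈ S, ∀ x, g (e c x) = e' c (f x)) : numComponents e S = numComponents e' S :=
  Nat.card_congr (Quotient.congr f (colorSetoid_congr f g h))

/-- Exchanging the two types of vertices allows insertions at black vertices to be treated as
insertions at white ones. -/
theorem numComponents_symm (hS : S.Nonempty) :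
    numComponents (fun c => (e c).symm) S = numComponents e S := by
  obtain ⟨c₀, h₀⟩ := hS
  have key : ∀ {W K : Type} (e : ι → W ≃ K) (x y : W), colorSetoid e S x y →
      colorSetoid (fun c => (e c).symm) S (e c₀ x) (e c₀ y) := by
    intro W K e x y hxy
    refine (colorSetoid_le (r := (colorSetoid (fun c => (e c).symm) S).comap (e c₀)) ?_) hxy
    intro c hc c' hc' x y h
    rw [Setoid.comap_rel]
    refine Setoid.trans' _ (colorSetoid_of_eq (c := c₀) (c' := c) (y := e c x) h₀ hc (by simp))
      (colorSetoid_of_eq (c := c') (c' := c₀) hc' h₀ ?_)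
    simp [h]
  refine (Nat.card_congr (Quotient.congr (e c₀) fun x y => ⟨key e x y, fun h => ?_⟩)).symm
  have h1 := key _ _ _ h
  simpa using h1

theorem numComponents_sigma {I : Type} [Finite I] {A B : I → Type} [∀ i, Finite (A i)]
    (e : ∀ i, ι → A i ≃ B i) :
    numComponents (fun c => Equiv.sigmaCongrRight fun i => e i c) S =
      ∑ᶠ i, numComponents (e i) S := by
  classical
  have := Fintype.ofFinite I
  rw [finsum_eq_sum_of_fintype]
  unfold numComponents
  rw [← Nat.card_sigma]
  refine Nat.card_congr (Equiv.ofBijective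
    (Quotient.lift (fun x : Σ i, A i => (⟨x.1, Quotient.mk (colorSetoid (e x.1) S) x.2⟩ :
      Σ i, Quotient (colorSetoid (e i) S))) ?_) ⟨?_, ?_⟩)
  · intro x y hxy
    refine (colorSetoid_le (r := Setoid.ker fun x : Σ i, A i =>
      (⟨x.1, Quotient.mk (colorSetoid (e x.1) S) x.2⟩ : Σ i, Quotient (colorSetoid (e i) S)))
      ?_) hxy
    rintro c hc c' hc' ⟨i, x⟩ ⟨j, y⟩ h
    simp only [Equiv.sigmaCongrRight_apply, Sigma.mk.injEq] at h
    obtain ⟨rfl, h⟩ := h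
    rw [Setoid.ker_def]
    simp only [Sigma.mk.injEq, heq_eq_eq, true_and]
    exact Quotient.sound (s := colorSetoid (e i) S) (colorSetoid_of_eq hc hc' (eq_of_heq h))
  · intro x y
    induction x using Quotient.inductionOn with | _ x
    induction y using Quotient.inductionOn with | _ y
    obtain ⟨i, x⟩ := x
    obtain ⟨j, y⟩ := y
    intro h
    simp only [Quotient.lift_mk, Sigma.mk.injEq] at h
    obtain ⟨rfl, h⟩ := h
    have h' := Quotient.exact (eq_of_heq h)
    apply Quotient.sound
    refine (colorSetoid_le (r := (colorSetoid (fun c => Equiv.sigmaCongrRight fun i => e i c)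
      S).comap (Sigma.mk i)) ?_) h'
    intro c hc c' hc' x y hx
    exact colorSetoid_of_eq hc hc' (by simp [hx])
  · rintro ⟨i, x⟩
    induction x using Quotient.inductionOn with | _ x
    exact ⟨Quotient.mk _ ⟨i, x⟩, rfl⟩

/-- Vertices at which all the matchings with colours in `S` agree can be discarded. -/
theorem numComponents_eq_subtype_add [Finite W] {P : W → Prop} {Q : K → Prop}
    (hPQ : ∀ c x, P x ↔ Q (e c x)) (hP : ∀ x, ¬ P x → ∀ c c', e c x = e c' x) :
    numComponents e S = numComponents (fun c => (e c).subtypeEquiv (hPQ c)) S +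
      Nat.card {x // ¬ P x} := by
  classical
  have hiso : ∀ x y, ¬ P x → colorSetoid e S x y → x = y := by
    intro x y hx hxy
    -- Coarsest relation in which each vertex outside `P` is alone; the generating steps respect it
    -- because all matchings agree there.
    let r : Setoid W := ⟨fun x y => x = y ∨ P x ∧ P y, by
      refine ⟨fun x => Or.inl rfl, ?_, ?_⟩
      · rintro x y (h | h)
        · exact Or.inl h.symm
        · exact Or.inr h.symm
      · rintro x y z (rfl | h) (rfl | h')
        · exact Or.inl rfl
        · exact Or.inr h'
        · exact Or.inr h
        · exact Or.inr ⟨h.1, h'.2⟩⟩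
    have hr : r x y := by
      refine (colorSetoid_le (r := r) ?_) hxy
      intro c hc c' hc' x y h
      by_cases hx : P x
      · exact Or.inr ⟨hx, (hPQ c' y).2 (h ▸ (hPQ c x).1 hx)⟩
      · left
        rw [hP x hx c c'] at h
        exact (e c').injective h
    exact hr.resolve_right fun h => hx h.1
  have := Fintype.ofFinite W
  unfold numComponents
  rw [← Nat.card_sum]
  symm
  refine Nat.card_congr (Equiv.ofBijective (Sum.elim
    (Quotient.map' Subtype.val fun x y hxy => ?_) fun x => Quotient.mk _ x.1) ⟨?_, ?_⟩)
  · refine (colorSetoid_le (r := (colorSetoid e S).comap Subtype.val) ?_) hxy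
    intro c hc c' hc' x y h
    exact colorSetoid_of_eq hc hc' (congrArg Subtype.val h)
  · rintro (x | x) (y | y) h
    · induction x using Quotient.inductionOn' with | _ x
      induction y using Quotient.inductionOn' with | _ y
      have h' : colorSetoid e S x y := Quotient.exact h
      congr 1
      apply Quotient.sound'
      have h2 := (colorSetoid_le (r := ⟨fun x y => x = y ∨ ∃ hx hy,
          colorSetoid (fun c => (e c).subtypeEquiv (hPQ c)) S ⟨x, hx⟩ ⟨y, hy⟩, ?_⟩) ?_) h'
      · rcases h2 with h2 | ⟨_, _, h2⟩
        · rw [Subtype.ext h2]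
        · exact h2
      · refine ⟨fun x => Or.inl rfl, ?_, ?_⟩
        · rintro x y (h | ⟨hx, hy, h⟩)
          · exact Or.inl h.symm
          · exact Or.inr ⟨hy, hx, Setoid.symm' _ h⟩
        · rintro x y z (rfl | ⟨hx, hy, h⟩) (rfl | ⟨hy', hz, h'⟩)
          · exact Or.inl rfl
          · exact Or.inr ⟨_, _, h'⟩
          · exact Or.inr ⟨_, _, h⟩
          · exact Or.inr ⟨_, _, Setoid.trans' _ h h'⟩
      · intro c hc c' hc' x y h
        by_cases hx : P x
        · have hy : P y := (hPQ c' y).2 (h ▸ (hPQ c x).1 hx)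
          exact Or.inr ⟨hx, hy, colorSetoid_of_eq hc hc' (Subtype.ext h)⟩
        · left
          rw [hP x hx c c'] at h
          exact (e c').injective h
    · induction x using Quotient.inductionOn' with | _ x
      have h' : colorSetoid e S x y := Quotient.exact h
      have := hiso y x y.2 (Setoid.symm' _ h')
      exact absurd (this ▸ x.2) y.2
    · induction y using Quotient.inductionOn' with | _ y
      have h' : colorSetoid e S x y := Quotient.exact h
      have := hiso x y x.2 h'
      exact absurd (this ▸ y.2) x.2
    · have h' : colorSetoid e S x y := Quotient.exact h
      rw [Subtype.ext (hiso x y x.2 h')]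
  · intro q
    induction q using Quotient.inductionOn' with | _ x
    by_cases hx : P x
    · exact ⟨Sum.inl (Quotient.mk _ ⟨x, hx⟩), rfl⟩
    · exact ⟨Sum.inr ⟨x, hx⟩, rfl⟩

end

/-! ## Connected components of coloured graphs -/

theorem SimpleGraph.fromRel_reachable_iff {V : Type*} (R : V → V → Prop) (a b : V) :
    (SimpleGraph.fromRel R).Reachable a b ↔ Relation.EqvGen R a b := by
  constructor
  · rintro ⟨p⟩
    induction p with
    | nil => exact Relation.EqvGen.refl _
    | cons h _ ih =>
      rw [SimpleGraph.fromRel_adj] at h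
      refine Relation.EqvGen.trans _ _ _ ?_ ih
      rcases h.2 with h | h
      · exact Relation.EqvGen.rel _ _ h
      · exact Relation.EqvGen.symm _ _ (Relation.EqvGen.rel _ _ h)
  · intro h
    induction h with
    | rel x y h =>
      by_cases hxy : x = y
      · subst hxy; rfl
      · exact SimpleGraph.Adj.reachable ((SimpleGraph.fromRel_adj _ _ _).2 ⟨hxy, Or.inl h⟩)
    | refl x => rfl
    | symm x y _ ih => exact ih.symm
    | trans x y z _ _ ih1 ih2 => exact ih1.trans ih2

/-- The relation on all vertices generated by the edges with colours in `S` and a set `L` of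
additional lines. -/
def lineSetoid {ι W K : Type} (e : ι → W ≃ K) (S : Set ι) (L : Set (W × K)) : Setoid (W ⊕ K) :=
  Relation.EqvGen.setoid fun a b => (∃ c ∈ S, ∃ w, a = Sum.inl w ∧ b = Sum.inr (e c w)) ∨
    ∃ p ∈ L, a = Sum.inl p.1 ∧ b = Sum.inr p.2

section

variable {ι W K : Type} {e : ι → W ≃ K} {S : Set ι} {L : Set (W × K)}

theorem lineSetoid_edge {c : ι} (hc : c ∈ S) (w : W) :
    lineSetoid e S L (Sum.inl w) (Sum.inr (e c w)) :=
  Relation.EqvGen.rel _ _ (Or.inl ⟨c, hc, w, rfl, rfl⟩)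

theorem lineSetoid_line {p : W × K} (hp : p ∈ L) :
    lineSetoid e S L (Sum.inl p.1) (Sum.inr p.2) :=
  Relation.EqvGen.rel _ _ (Or.inr ⟨p, hp, rfl, rfl⟩)

theorem lineSetoid_le {r : Setoid (W ⊕ K)}
    (h1 : ∀ c ∈ S, ∀ w, r (Sum.inl w) (Sum.inr (e c w)))
    (h2 : ∀ p ∈ L, r (Sum.inl p.1) (Sum.inr p.2)) : lineSetoid e S L ≤ r := by
  refine eqvGen_setoid_le ?_
  rintro x y (⟨c, hc, w, rfl, rfl⟩ | ⟨p, hp, rfl, rfl⟩)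
  · exact h1 c hc w
  · exact h2 p hp

theorem lineSetoid_inl_of_colorSetoid {x y : W} (h : colorSetoid e S x y) :
    lineSetoid e S L (Sum.inl x) (Sum.inl y) := by
  refine (colorSetoid_le (r := (lineSetoid e S L).comap Sum.inl) ?_) h
  intro c hc c' hc' x y h
  rw [Setoid.comap_rel]
  refine Setoid.trans' _ (lineSetoid_edge hc x) (Setoid.symm' _ ?_)
  rw [h]
  exact lineSetoid_edge hc' y

theorem lineSetoid_inl_iff (hS : S.Nonempty) {x y : W} :
    lineSetoid e S ∅ (Sum.inl x) (Sum.inl y) ↔ colorSetoid e S x y := by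
  refine ⟨fun h => ?_, lineSetoid_inl_of_colorSetoid⟩
  obtain ⟨c₀, h₀⟩ := hS
  -- Each black vertex is projected to its white neighbour of colour `c₀`.
  refine (lineSetoid_le (r := (colorSetoid e S).comap (Sum.elim id (e c₀).symm)) ?_ (by simp)) h
  intro c hc w
  exact colorSetoid_of_eq hc h₀ (by simp)

end

namespace ColoredGraph

variable {ι : Type} (X : ColoredGraph ι) {S : Set ι}

theorem colorSubgraph_reachable_iff {a b : X.W ⊕ X.K} :
    (X.colorSubgraph S).Reachable a b ↔ lineSetoid X.edge S ∅ a b := by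
  unfold colorSubgraph
  rw [SimpleGraph.fromRel_reachable_iff]
  change _ ↔ Relation.EqvGen _ a b
  simp only [Set.mem_empty_iff_false, false_and, exists_false, or_false]

theorem card_connectedComponent (hS : S.Nonempty) :
    Nat.card (X.colorSubgraph S).ConnectedComponent = numComponents X.edge S := by
  symm
  refine Nat.card_congr (Equiv.ofBijective (Quotient.lift
    (fun w => (X.colorSubgraph S).connectedComponentMk (Sum.inl w)) ?_) ⟨?_, ?_⟩)
  · intro x y h
    rw [SimpleGraph.ConnectedComponent.eq, colorSubgraph_reachable_iff]
    exact lineSetoid_inl_of_colorSetoid h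
  · intro x y
    induction x using Quotient.inductionOn with | _ x
    induction y using Quotient.inductionOn with | _ y
    intro h
    simp only [Quotient.lift_mk] at h
    rw [SimpleGraph.ConnectedComponent.eq, colorSubgraph_reachable_iff, lineSetoid_inl_iff hS] at h
    exact Quotient.sound h
  · intro C
    induction C using SimpleGraph.ConnectedComponent.ind with | _ v
    obtain ⟨c, hc⟩ := hS
    obtain v | v := v
    · exact ⟨Quotient.mk _ v, rfl⟩
    · refine ⟨Quotient.mk _ ((X.edge c).symm v), ?_⟩
      simp only [Quotient.lift_mk]
      rw [SimpleGraph.ConnectedComponent.eq, colorSubgraph_reachable_iff]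
      simpa using lineSetoid_edge (e := X.edge) (L := ∅) hc ((X.edge c).symm v)

theorem numCycles_eq (i j : ι) :
    X.numCycles i j = Equiv.Perm.numOrbits ((X.edge j).trans (X.edge i).symm) := by
  unfold numCycles
  rw [card_connectedComponent X ⟨i, by simp⟩, numComponents_pair]

theorem connected_iff [Nonempty ι] :
    X.Connected ↔ Nonempty X.W ∧ ∀ x y, colorSetoid X.edge Set.univ x y := by
  have h : Nat.card (X.colorSubgraph Set.univ).ConnectedComponent = 1 ↔ X.Connected := by
    rw [Nat.card_eq_one_iff_unique]
    constructor
    · rintro ⟨h1, ⟨C⟩⟩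
      induction C using SimpleGraph.ConnectedComponent.ind with | _ v
      have : Nonempty (X.W ⊕ X.K) := ⟨v⟩
      exact ⟨fun a b => SimpleGraph.ConnectedComponent.exact (h1.elim _ _)⟩
    · intro h
      obtain ⟨v⟩ := h.nonempty
      exact ⟨⟨fun a b => by
        induction a using SimpleGraph.ConnectedComponent.ind with | _ a
        induction b using SimpleGraph.ConnectedComponent.ind with | _ b
        exact SimpleGraph.ConnectedComponent.sound (h.preconnected a b)⟩,
        ⟨SimpleGraph.connectedComponentMk _ v⟩⟩
  rw [← h, card_connectedComponent X Set.univ_nonempty, numComponents,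
    Setoid.card_quotient_eq_one_iff]

end ColoredGraph

/-! ## Families of permutations generated by coloured transpositions -/

open Classical in
/-- The transposition of `a` and `b` for the colours in `C`, the identity for the others. -/
noncomputable def swapIn {d : ℕ} {W : Type} (C : Finset (Fin d)) (a b : W) (c : Fin d) :
    Equiv.Perm W :=
  if c ∈ C then Equiv.swap a b else 1

theorem swapIn_of_mem {d : ℕ} {W : Type} [DecidableEq W] {C : Finset (Fin d)} {c : Fin d}
    (h : c ∈ C) (a b : W) : swapIn C a b c = Equiv.swap a b := by
  rw [swapIn, if_pos h]
  congr!

theorem swapIn_of_notMem {d : ℕ} {W : Type} {C : Finset (Fin d)} {c : Fin d}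
    (h : c ∉ C) (a b : W) : swapIn C a b c = 1 := if_neg h

/-- The families of permutations `f c` which are products of transpositions, each of them appearing
for the colours in a given set only; `m` is the multiset of these sets. -/
inductive SwapGen {d : ℕ} {W : Type} :
    (Fin d → Equiv.Perm W) → Multiset (Finset (Fin d)) → Prop
  | one : SwapGen (fun _ => 1) 0
  | mul_swap {f : Fin d → Equiv.Perm W} {m : Multiset (Finset (Fin d))} (h : SwapGen f m)
      (C : Finset (Fin d)) (a b : W) : SwapGen (fun c => f c * swapIn C a b c) (C ::ₘ m)

namespace SwapGen

variable {d : ℕ} {W W' : Type} {f g : Fin d → Equiv.Perm W} {m m' : Multiset (Finset (Fin d))}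

theorem swap (C : Finset (Fin d)) (a b : W) : SwapGen (swapIn C a b) {C} := by
  simpa using mul_swap one C a b

theorem mul (hf : SwapGen f m) (hg : SwapGen g m') :
    SwapGen (fun c => f c * g c) (m + m') := by
  induction hg with
  | one => simpa using hf
  | mul_swap h C a b ih =>
    have := ih.mul_swap C a b
    simpa only [mul_assoc, Multiset.add_cons] using this

theorem map (hf : SwapGen f m) (φ : Equiv.Perm W →* Equiv.Perm W')
    (hφ : ∀ (C : Finset (Fin d)) a b, ∃ a' b', ∀ c, φ (swapIn C a b c) = swapIn C a' b' c) :
    SwapGen (fun c => φ (f c)) m := by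
  induction hf with
  | one => simpa using one
  | mul_swap h C a b ih =>
    obtain ⟨a', b', h'⟩ := hφ C a b
    simpa only [map_mul, h'] using ih.mul_swap C a' b'

theorem sum_numOrbits_le [Finite W] (π : Equiv.Perm W) (f : Fin d → Equiv.Perm W)
    (C : Finset (Fin d)) (a b : W) :
    ∑ c, (π * f c).numOrbits ≤ ∑ c, (π * (f c * swapIn C a b c)).numOrbits + C.card := by
  classical
  have h : C.card = ∑ c, if c ∈ C then 1 else 0 := by simp
  rw [h, ← Finset.sum_add_distrib]
  refine Finset.sum_le_sum fun c _ => ?_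
  unfold swapIn
  split_ifs
  · rw [← mul_assoc]; exact Equiv.Perm.numOrbits_le_numOrbits_mul_swap _ _ _
  · simp

theorem sum_numOrbits_mul_le [Finite W] (π : Equiv.Perm W) (f : Fin d → Equiv.Perm W)
    (C : Finset (Fin d)) (a b : W) :
    ∑ c, (π * (f c * swapIn C a b c)).numOrbits ≤ ∑ c, (π * f c).numOrbits + C.card := by
  classical
  have h : C.card = ∑ c, if c ∈ C then 1 else 0 := by simp
  rw [h, ← Finset.sum_add_distrib]
  refine Finset.sum_le_sum fun c _ => ?_
  unfold swapIn
  split_ifs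
  · rw [← mul_assoc]; exact Equiv.Perm.numOrbits_mul_swap_le _ _ _
  · simp

theorem sum_numOrbits_eq [Finite W] (π : Equiv.Perm W) (f : Fin d → Equiv.Perm W)
    (C : Finset (Fin d)) (a b : W) (h : ∀ c, ¬ Equiv.Perm.SameCycle (π * f c) a b) :
    ∑ c, (π * f c).numOrbits = ∑ c, (π * (f c * swapIn C a b c)).numOrbits + C.card := by
  classical
  have h' : C.card = ∑ c, if c ∈ C then 1 else 0 := by simp
  rw [h', ← Finset.sum_add_distrib]
  refine Finset.sum_congr rfl fun c _ => ?_
  unfold swapIn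
  split_ifs
  · rw [← mul_assoc]; exact Equiv.Perm.numOrbits_mul_swap_of_not_sameCycle (h c)
  · simp

/-- The lower bound on the number of cycles: a transposition removes at most one cycle. -/
theorem numOrbits_lower_bound [Finite W] (hf : SwapGen f m) (π : Equiv.Perm W) :
    d * π.numOrbits ≤ ∑ c, (π * f c).numOrbits + (m.map Finset.card).sum := by
  induction hf with
  | one => simp
  | @mul_swap f m h C a b ih =>
    have := sum_numOrbits_le π f C a b
    simp only [Multiset.map_cons, Multiset.sum_cons]
    omega

/-- The upper bound on the number of cycles in terms of the number of classes of a relation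
preserved by all the permutations: a transposition inside a class creates at most `|C| ≤ d - |C|`
cycles, a transposition merging two classes removes `|C|` cycles. -/
theorem numOrbits_upper_bound [Finite W] (hf : SwapGen f m) (hm : ∀ C ∈ m, 2 * C.card ≤ d)
    (π : Equiv.Perm W) :
    ∃ r : Setoid W, (∀ c, Equiv.Perm.SameCycle.setoid (π * f c) ≤ r) ∧
      ∑ c, (π * f c).numOrbits + (m.map Finset.card).sum ≤
        d * Nat.card (Quotient r) + d * Multiset.card m := by
  classical
  induction hf with
  | one =>
    exact ⟨Equiv.Perm.SameCycle.setoid π, by simp, by simp [Equiv.Perm.numOrbits]⟩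
  | @mul_swap f m h C a b ih =>
    obtain ⟨r, h1, h2⟩ := ih fun D hD => hm D (Multiset.mem_cons_of_mem hD)
    have hC := hm C (Multiset.mem_cons_self C m)
    -- The glued relation serves in both cases: it equals `r` when `a` and `b` are already related.
    refine ⟨r.glue a b, fun c => ?_, ?_⟩
    · change Equiv.Perm.SameCycle.setoid (π * (f c * swapIn C a b c)) ≤ _
      by_cases hc : c ∈ C
      · rw [swapIn_of_mem hc, ← mul_assoc]
        refine le_trans (Setoid.le_glue (a := a) (b := b)) ?_
        rw [Equiv.Perm.sameCycle_setoid_glue_swap]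
        exact Setoid.glue_le ((h1 c).trans Setoid.le_glue) Setoid.glue_pair
      · rw [swapIn_of_notMem hc, mul_one]
        exact (h1 c).trans Setoid.le_glue
    · simp only [Multiset.map_cons, Multiset.sum_cons, Multiset.card_cons]
      by_cases hab : r a b
      · rw [Setoid.glue_eq_of_rel hab]
        have := sum_numOrbits_mul_le π f C a b
        linarith
      · have e1 := sum_numOrbits_eq π f C a b fun c hc => hab (h1 c hc)
        have e2 := Setoid.card_quotient_eq_card_glue_add_one hab
        rw [e2] at h2
        linarith

/-- Blocks are multiplied in one at a time; extending a permutation of one block by the identity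
sends transpositions to transpositions, uniformly in the colour. -/
theorem sigma {I : Type} [Finite I] {A : I → Type} {f : ∀ i, Fin d → Equiv.Perm (A i)}
    {m : I → Multiset (Finset (Fin d))} (h : ∀ i, SwapGen (f i) (m i)) :
    SwapGen (fun c => (Equiv.sigmaCongrRight fun i => f i c : Equiv.Perm (Σ i, A i)))
      (∑ᶠ i, m i) := by
  classical
  have := Fintype.ofFinite I
  rw [finsum_eq_sum_of_fintype]
  have key : ∀ s : Finset I, SwapGen (fun c => Equiv.Perm.sigmaCongrRightHom A
      (fun i => if i ∈ s then f i c else 1)) (∑ i ∈ s, m i) := by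
    intro s
    induction s using Finset.induction_on with
    | empty =>
      simp only [Finset.notMem_empty, if_false, Finset.sum_empty]
      have : (fun _ => 1 : ∀ i, Equiv.Perm (A i)) = 1 := rfl
      simpa [this] using one
    | insert j s hj ih =>
      rw [Finset.sum_insert hj]
      have h1 : SwapGen (fun c => ((Equiv.Perm.sigmaCongrRightHom A).comp
          (MonoidHom.mulSingle (fun i => Equiv.Perm (A i)) j)) (f j c)) (m j) := by
        refine (h j).map _ fun C a b => ⟨⟨j, a⟩, ⟨j, b⟩, fun c => ?_⟩
        by_cases hc : c ∈ C
        · rw [swapIn_of_mem hc, swapIn_of_mem hc]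
          ext1 ⟨i, x⟩
          by_cases hi : i = j
          · subst hi
            by_cases hxa : x = a
            · subst hxa; simp [Equiv.sigmaCongrRight]
            · by_cases hxb : x = b
              · subst hxb; simp [Equiv.sigmaCongrRight]
              · simp [Equiv.sigmaCongrRight, Equiv.swap_apply_of_ne_of_ne, hxa, hxb]
          · rw [Equiv.swap_apply_of_ne_of_ne] <;> simp [Equiv.sigmaCongrRight, hi]
        · rw [swapIn_of_notMem hc, swapIn_of_notMem hc]
          exact map_one _
      refine cast ?_ (h1.mul ih)
      congr 1
      ext1 c
      rw [MonoidHom.comp_apply, ← map_mul]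
      congr 1
      funext i
      by_cases hi : i = j
      · subst hi; simp [hj]
      · simp [hi]
  have := key Finset.univ
  simpa using this

end SwapGen

/-! ### Bidipole insertions as products with transpositions. -/

/-- The permutations of `Option α` induced by the permutations of `α`. -/
def Equiv.Perm.optionHom (α : Type) : Equiv.Perm α →* Equiv.Perm (Option α) where
  toFun f := Equiv.optionCongr f
  map_one' := by ext1 x; cases x <;> rfl
  map_mul' f g := by ext1 x; cases x <;> rfl

theorem Equiv.Perm.optionHom_swapIn {d : ℕ} {W : Type} (C : Finset (Fin d)) (a b : W)
    (c : Fin d) : Equiv.Perm.optionHom W (swapIn C a b c) = swapIn C (some a) (some b) c := by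
  classical
  by_cases hc : c ∈ C
  · rw [swapIn_of_mem hc, swapIn_of_mem hc]
    exact Equiv.optionCongr_swap a b
  · rw [swapIn_of_notMem hc, swapIn_of_notMem hc]
    exact map_one _

theorem Equiv.optionCongr_trans_eq {α β : Type} (f : Equiv.Perm α) (e : α ≃ β) :
    Equiv.optionCongr (Equiv.trans f e) =
      (Equiv.Perm.optionHom α f).trans (Equiv.optionCongr e) := by
  ext1 x; cases x <;> rfl

theorem ColoredGraph.insertWhite_edge {d : ℕ} (X : ColoredGraph (Fin d)) (C : Finset (Fin d))
    (u : X.W) (c : Fin d) : (X.insertWhite C u).edge c =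
      (Equiv.trans (swapIn C (some u) none c) (X.edge c).optionCongr :
        Option X.W ≃ Option X.K) := by
  by_cases hc : c ∈ C
  · exact (if_pos hc).trans (congrArg (fun s => Equiv.trans s (X.edge c).optionCongr)
      (@swapIn_of_mem _ _ (_) _ _ hc _ _).symm)
  · exact (if_neg hc).trans (congrArg (fun s => Equiv.trans s (X.edge c).optionCongr)
      (swapIn_of_notMem hc _ _).symm)

theorem ColoredGraph.insertBlack_edge {d : ℕ} (X : ColoredGraph (Fin d)) (C : Finset (Fin d))
    (u : X.K) (c : Fin d) : (X.insertBlack C u).edge c =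
      (Equiv.trans (X.edge c).optionCongr (swapIn C (some u) none c) :
        Option X.W ≃ Option X.K) := by
  by_cases hc : c ∈ C
  · exact (if_pos hc).trans (congrArg (fun s => Equiv.trans (X.edge c).optionCongr s)
      (@swapIn_of_mem _ _ (_) _ _ hc _ _).symm)
  · exact (if_neg hc).trans (congrArg (fun s => Equiv.trans (X.edge c).optionCongr s)
      (swapIn_of_notMem hc _ _).symm)

/-- An insertion at a white vertex multiplies `f` on the right by a coloured transposition. At a
black vertex the transposition acts after the matching; pulled back through `e` it becomes a
transposition of white vertices on the left. The reference matching `e` is the same for all colours.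
-/
theorem GMBuild.exists_swapGen {d : ℕ} {B : ColoredGraph (Fin d)}
    {m : Multiset (Finset (Fin d))} (h : GMBuild B m) :
    ∃ (e : B.W ≃ B.K) (f : Fin d → Equiv.Perm B.W), SwapGen f m ∧
      ∀ c, B.edge c = (f c).trans e := by
  classical
  induction h with
  | two => exact ⟨Equiv.refl _, fun _ => 1, SwapGen.one, fun _ => rfl⟩
  | @white B m h C hC u ih =>
    obtain ⟨e, f, hf, he⟩ := ih
    refine ⟨Equiv.optionCongr e, fun c => Equiv.Perm.optionHom _ (f c) * swapIn C (some u) none c,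
      (hf.map (Equiv.Perm.optionHom _) fun C a b =>
        ⟨some a, some b, Equiv.Perm.optionHom_swapIn C a b⟩).mul_swap C _ _, fun c => ?_⟩
    refine (B.insertWhite_edge C u c).trans ?_
    rw [he, Equiv.optionCongr_trans_eq]
    rfl
  | @black B m h C hC u ih =>
    obtain ⟨e, f, hf, he⟩ := ih
    refine ⟨Equiv.optionCongr e,
      fun c => swapIn C (some (e.symm u)) none c * Equiv.Perm.optionHom _ (f c), ?_, fun c => ?_⟩
    · have := (SwapGen.swap C (some (e.symm u)) none).mul
        (hf.map (Equiv.Perm.optionHom _) fun C a b =>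
          ⟨some a, some b, Equiv.Perm.optionHom_swapIn C a b⟩)
      rwa [Multiset.singleton_add] at this
    refine (B.insertBlack_edge C u c).trans ?_
    rw [he, Equiv.optionCongr_trans_eq]
    have h1 : Equiv.trans (swapIn C (some (e.symm u)) none c) e.optionCongr =
        e.optionCongr.trans (swapIn C (some u) none c) := by
      by_cases hc : c ∈ C
      · rw [swapIn_of_mem hc, swapIn_of_mem hc]
        ext1 x
        simp [e.optionCongr.injective.map_swap]
      · rw [swapIn_of_notMem hc, swapIn_of_notMem hc]
        rfl
    exact (congrArg (Equiv.trans (Equiv.Perm.optionHom _ (f c))) h1).symm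
  | @iso B B' m h ι ih =>
    obtain ⟨e, f, hf, he⟩ := ih
    refine ⟨ι.onW.symm.trans (e.trans ι.onK), fun c => ι.onW.permCongrHom (f c),
      hf.map (ι.onW.permCongrHom : _ →* _) fun C a b => ⟨ι.onW a, ι.onW b, fun c => ?_⟩,
      fun c => ?_⟩
    · by_cases hc : c ∈ C
      · rw [swapIn_of_mem hc, swapIn_of_mem hc]
        ext1 x
        obtain ⟨x, rfl⟩ := ι.onW.surjective x
        simp [Equiv.permCongr_apply, ι.onW.injective.map_swap]
      · rw [swapIn_of_notMem hc, swapIn_of_notMem hc]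
        exact map_one _
    · ext1 x
      have := ι.comm c (ι.onW.symm x)
      rw [ι.onW.apply_symm_apply, he] at this
      rw [← this]
      simp [Equiv.permCongr_apply]

/-! ## Components of generalized melonic bubbles -/

section

variable {ι W K : Type} {e : ι → W ≃ K}

theorem numComponents_optionCongr [Finite W] {S : Set ι} :
    numComponents (fun c => (e c).optionCongr) S = numComponents e S + 1 := by
  rw [numComponents_eq_subtype_add (P := fun x => x.isSome = true) (Q := fun x => x.isSome = true)
    (by intro c x; cases x <;> simp) (by
      intro x hx c c'
      cases x
      · rfl
      · simp at hx)]
  congr 1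
  · symm
    refine numComponents_congr (Equiv.optionIsSomeEquiv W).symm (Equiv.optionIsSomeEquiv K).symm ?_
    intro c _ x
    rfl
  · rw [Nat.card_eq_one_iff_unique]
    refine ⟨⟨?_⟩, ⟨⟨none, by simp⟩⟩⟩
    rintro ⟨_ | x, hx⟩ ⟨_ | y, hy⟩
    · rfl
    all_goals simp at hx hy

variable {d : ℕ} {e : Fin d → W ≃ K}

/-- A colour of `S` inside `C` and one outside `C` join both `some u` and `none` to the new black
vertex. Identifying these two white vertices then recovers the components of the old graph. -/
theorem numComponents_bidipole_of_crossing {S C : Finset (Fin d)} (u : W) {c₁ c₂ : Fin d}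
    (h₁ : c₁ ∈ S) (h₂ : c₂ ∈ S) (hc₁ : c₁ ∈ C) (hc₂ : c₂ ∉ C) :
    numComponents (fun c => Equiv.trans (swapIn C (some u) none c) (e c).optionCongr) (S : Set _) =
      numComponents e (S : Set _) := by
  classical
  set e' : Fin d → Option W ≃ Option K :=
    fun c => Equiv.trans (swapIn C (some u) none c) (e c).optionCongr with he'
  have hun : colorSetoid e' (S : Set _) (some u) none := by
    refine colorSetoid_of_eq (c := c₁) (c' := c₂) h₁ h₂ ?_
    simp [he', swapIn_of_mem hc₁, swapIn_of_notMem hc₂]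
  have hswap : ∀ c x, colorSetoid e' (S : Set _) (swapIn C (some u) none c x) x := by
    intro c x
    by_cases hc : c ∈ C
    · rw [swapIn_of_mem hc, Equiv.swap_apply_def]
      split_ifs with h h
      · rw [h]; exact Setoid.symm' _ hun
      · rw [h]; exact hun
      · exact Setoid.refl' _ _
    · rw [swapIn_of_notMem hc]; exact Setoid.refl' _ _
  -- Collapsing `none` onto `u` undoes the transposition for every colour.
  have hF : ∀ c (x : Option W), (swapIn C (some u) none c x).getD u = x.getD u := by
    intro c x
    by_cases hc : c ∈ C
    · rw [swapIn_of_mem hc, Equiv.swap_apply_def]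
      split_ifs with h h <;> simp [h]
    · rw [swapIn_of_notMem hc]; rfl
  symm
  refine Nat.card_congr (Equiv.ofBijective (Quotient.map' some ?_) ⟨?_, ?_⟩)
  · intro x y hxy
    refine (colorSetoid_le (r := (colorSetoid e' (S : Set _)).comap some) ?_) hxy
    intro c hc c' hc' x y h
    rw [Setoid.comap_rel]
    have h1 : ∀ c z, swapIn C (some u) none c (swapIn C (some u) none c z) = z := by
      intro c z
      by_cases hc : c ∈ C
      · rw [swapIn_of_mem hc]; simp
      · rw [swapIn_of_notMem hc]; rfl
    have h2 : colorSetoid e' (S : Set _) (swapIn C (some u) none c (some x))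
        (swapIn C (some u) none c' (some y)) := by
      refine colorSetoid_of_eq hc hc' ?_
      simp only [he', Equiv.trans_apply, h1]
      simp [h]
    exact Setoid.trans' _ (Setoid.symm' _ (hswap c _)) (Setoid.trans' _ h2 (hswap c' _))
  · intro x y
    induction x using Quotient.inductionOn' with | _ x
    induction y using Quotient.inductionOn' with | _ y
    intro h
    have h' : colorSetoid e' (S : Set _) (some x) (some y) := Quotient.exact h
    apply Quotient.sound'
    refine (colorSetoid_le (r := (colorSetoid e (S : Set _)).comap fun x : Option W => x.getD u)
      ?_) h'
    intro c hc c' hc' x y h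
    rw [Setoid.comap_rel, ← hF c x, ← hF c' y]
    simp only [he', Equiv.trans_apply] at h
    generalize (swapIn C (some u) none c) x = x at h
    generalize (swapIn C (some u) none c') y = y at h
    cases x <;> cases y
    · exact Setoid.refl' _ _
    · simp at h
    · simp at h
    · exact colorSetoid_of_eq hc hc' (by simpa using h)
  · intro q
    induction q using Quotient.inductionOn' with | _ x
    cases x with
    | some x => exact ⟨Quotient.mk _ x, rfl⟩
    | none => exact ⟨Quotient.mk _ u, Quotient.sound hun⟩

/-- A bidipole insertion adds one component if and only if `S` does not cross `C`. -/
theorem numComponents_bidipole [Finite W] {S : Finset (Fin d)} (C : Finset (Fin d)) (u : W) :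
    numComponents (fun c => Equiv.trans (swapIn C (some u) none c) (e c).optionCongr) (S : Set _) =
      numComponents e (S : Set _) + if S ⊆ C ∨ Disjoint S C then 1 else 0 := by
  classical
  split_ifs with h
  · rw [← numComponents_optionCongr]
    -- In both cases `S` sees, up to renaming `some u` and `none`, the old graph with an isolated
    -- pair of vertices.
    rcases h with h | h
    · refine numComponents_congr (Equiv.swap (some u) none) (Equiv.refl _) ?_
      intro c hc x
      rw [swapIn_of_mem (h hc)]
      rfl
    · refine numComponents_congr (Equiv.refl _) (Equiv.refl _) ?_
      intro c hc x
      rw [swapIn_of_notMem (Finset.disjoint_left.1 h hc)]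
      rfl
  · rw [not_or, Finset.not_subset, Finset.not_disjoint_iff] at h
    obtain ⟨⟨c₂, h₂, hc₂⟩, ⟨c₁, h₁, hc₁⟩⟩ := h
    exact numComponents_bidipole_of_crossing u h₁ h₂ hc₁ hc₂

theorem swapIn_symm (C : Finset (Fin d)) (a b : W) (c : Fin d) :
    Equiv.symm (swapIn C a b c) = swapIn C a b c := by
  classical
  by_cases hc : c ∈ C
  · rw [swapIn_of_mem hc]; exact Equiv.symm_swap a b
  · rw [swapIn_of_notMem hc]; rfl

end

namespace GMBuild

variable {d : ℕ} {B : ColoredGraph (Fin d)} {m : Multiset (Finset (Fin d))}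

theorem admissible (h : GMBuild B m) : ∀ C ∈ m, AdmissibleSet C := by
  induction h with
  | two => simp
  | white h C hC u ih => intro D hD; rcases Multiset.mem_cons.1 hD with rfl | hD; exacts [hC, ih D hD]
  | black h C hC u ih => intro D hD; rcases Multiset.mem_cons.1 hD with rfl | hD; exacts [hC, ih D hD]
  | iso h e ih => exact ih

theorem card_W (h : GMBuild B m) : Nat.card B.W = Multiset.card m + 1 := by
  induction h with
  | two => simp [ColoredGraph.twoVertex]
  | @white B m h C hC u ih =>
    change Nat.card (Option B.W) = _
    rw [Finite.card_option, ih, Multiset.card_cons]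
  | @black B m h C hC u ih =>
    change Nat.card (Option B.W) = _
    rw [Finite.card_option, ih, Multiset.card_cons]
  | iso h e ih => rw [← ih]; exact (Nat.card_congr e.onW).symm

theorem numVertices_eq (h : GMBuild B m) : B.numVertices = 2 * Multiset.card m + 2 := by
  obtain ⟨e, -⟩ := h.exists_swapGen
  rw [ColoredGraph.numVertices, ← Nat.card_congr e, h.card_W]
  ring

/-- These numbers depend on the bubble only and will determine `m`. Every insertion whose colour set
is not crossed by `S` adds one component; the others add none. -/
theorem numComponents_eq (h : GMBuild B m) {S : Finset (Fin d)} (hS : S.Nonempty) :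
    numComponents B.edge (S : Set (Fin d)) = 1 + m.countP fun C => S ⊆ C ∨ Disjoint S C := by
  induction h with
  | two =>
    have hone : Nat.card (Quotient (colorSetoid (ColoredGraph.twoVertex (Fin d)).edge
        (S : Set (Fin d)))) = 1 := by
      have : Subsingleton (ColoredGraph.twoVertex (Fin d)).W := inferInstanceAs (Subsingleton Unit)
      rw [Setoid.card_quotient_eq_one_iff]
      exact ⟨⟨()⟩, fun x y => by rw [Subsingleton.elim x y]⟩
    simpa [numComponents] using hone
  | @white B m h C hC u ih =>
    have : (B.insertWhite C u).edge = fun c => (Equiv.trans (swapIn C (some u) none c)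
        (B.edge c).optionCongr : Option B.W ≃ Option B.K) :=
      funext fun c => B.insertWhite_edge C u c
    rw [this]
    refine (numComponents_bidipole C u).trans ?_
    rw [ih, Multiset.countP_cons, add_assoc]
  | @black B m h C hC u ih =>
    have : (B.insertBlack C u).edge = fun c => (Equiv.trans (B.edge c).optionCongr
        (swapIn C (some u) none c) : Option B.W ≃ Option B.K) :=
      funext fun c => B.insertBlack_edge C u c
    have h1 : ∀ c, (Equiv.trans (B.edge c).optionCongr
        (swapIn C (some u) none c) : Option B.W ≃ Option B.K).symm =
        Equiv.trans (swapIn C (some u) none c) (B.edge c).symm.optionCongr := by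
      intro c
      refine Equiv.ext fun x => ?_
      change (B.edge c).optionCongr.symm (Equiv.symm (swapIn C (some u) none c) x) = _
      rw [swapIn_symm]
      rfl
    rw [this]
    refine (numComponents_symm hS).symm.trans ?_
    refine (congrArg (fun e => numComponents e (S : Set (Fin d))) (funext h1)).trans ?_
    refine (numComponents_bidipole (e := fun c => (B.edge c).symm) C u).trans ?_
    rw [numComponents_symm hS, ih, Multiset.countP_cons, add_assoc]
  | @iso B B' m h ε ih =>
    rw [← ih]
    exact (numComponents_congr ε.onW ε.onK fun c _ x => ε.comm c x).symm

end GMBuild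

theorem AdmissibleSet.not_univ_subset {d : ℕ} {C : Finset (Fin d)} (h : AdmissibleSet C)
    (hd : 0 < d) : ¬ (Finset.univ ⊆ C ∨ Disjoint Finset.univ C) := by
  rintro (h' | h')
  · have : C = Finset.univ := Finset.univ_subset_iff.1 h'
    have h2 := h.2.1
    rw [this, Finset.card_univ, Fintype.card_fin] at h2
    omega
  · obtain ⟨c, hc⟩ := h.1
    exact Finset.disjoint_left.1 h' (Finset.mem_univ c) hc

/-- The set of all colours crosses every admissible set, so no insertion adds a component. -/
theorem GMBuild.connected {d : ℕ} {B : ColoredGraph (Fin d)} {m : Multiset (Finset (Fin d))}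
    (h : GMBuild B m) (hd : 0 < d) : Nonempty B.W ∧ ∀ x y, colorSetoid B.edge Set.univ x y := by
  have : NeZero d := ⟨hd.ne'⟩
  have h1 := h.numComponents_eq (S := Finset.univ) Finset.univ_nonempty
  rw [Multiset.countP_eq_zero.2 fun C hC => (h.admissible C hC).not_univ_subset hd, add_zero,
    Finset.coe_univ] at h1
  exact Setoid.card_quotient_eq_one_iff.1 h1

/-! ## Quartic and melonic bubbles -/

/-- A single insertion in the two-vertex bubble gives `Q_C`, so the general bounds apply to the
quartic model as well. -/
theorem gmBuild_quartic {d : ℕ} {C : Finset (Fin d)} (hC : AdmissibleSet C) :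
    GMBuild (ColoredGraph.quartic C) {C} := by
  classical
  let ε : Option Unit ≃ Fin 2 :=
    { toFun := fun x => if x = none then 1 else 0
      invFun := fun x => if x = 1 then none else some ()
      left_inv := by rintro (_ | ⟨⟩) <;> simp
      right_inv := by intro x; fin_cases x <;> simp }
  refine GMBuild.iso (GMBuild.white GMBuild.two C hC ()) ⟨ε, ε, fun c w => ?_⟩
  change Option Unit at w
  refine (congrArg (fun g : Option Unit ≃ Option Unit => ε (g w))
    ((ColoredGraph.twoVertex (Fin d)).insertWhite_edge C () c)).trans ?_
  change ε ((Equiv.optionCongr (Equiv.refl Unit)) (swapIn C (some ()) none c w)) =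
    (if c ∈ C then Equiv.swap 0 1 else Equiv.refl _ : Equiv.Perm (Fin 2)) (ε w)
  by_cases hc : c ∈ C
  · rw [swapIn_of_mem hc, if_pos hc]
    rcases w with _ | ⟨⟩ <;> simp [ε]
  · rw [swapIn_of_notMem hc, if_neg hc]
    rcases w with _ | ⟨⟩ <;> simp [ε]

/-- Insertions with `|C| = 1` are the melonic dipole insertions, on both types of vertices. -/
theorem ColoredGraph.insertDipole_edge {d : ℕ} (X : ColoredGraph (Fin d)) (c : Fin d) (u : X.W)
    (c' : Fin d) : (X.insertDipole c u).edge c' =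
      (Equiv.trans (swapIn {c} (some u) none c') (X.edge c').optionCongr :
        Option X.W ≃ Option X.K) := by
  by_cases hc : c' = c
  · exact (if_pos hc).trans (congrArg (fun s => Equiv.trans s (X.edge c').optionCongr)
      (@swapIn_of_mem _ _ (_) _ _ (Finset.mem_singleton.2 hc) _ _).symm)
  · exact (if_neg hc).trans (congrArg (fun s => Equiv.trans s (X.edge c').optionCongr)
      (swapIn_of_notMem (mt Finset.mem_singleton.1 hc) _ _).symm)

theorem IsMelonic.exists_gmBuild {d : ℕ} (hd : 3 ≤ d) {B : ColoredGraph (Fin d)}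
    (h : IsMelonic B) : ∃ m, GMBuild B m ∧ ∀ C ∈ m, C.card = 1 := by
  induction h with
  | two => exact ⟨0, GMBuild.two, by simp⟩
  | @dipole B h c u ih =>
    obtain ⟨m, hm, h1⟩ := ih
    -- `3 ≤ d` gives `2 < d`, so the condition on the first colour at `|C| = d/2` is vacuous.
    have hc : AdmissibleSet ({c} : Finset (Fin d)) :=
      ⟨by simp, by simp; omega, fun h => by simp at h; omega⟩
    refine ⟨{c} ::ₘ m, GMBuild.iso (GMBuild.white hm {c} hc u)
      ⟨Equiv.refl (Option B.W), Equiv.refl (Option B.K), fun c' w => ?_⟩, ?_⟩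
    · rw [B.insertWhite_edge, B.insertDipole_edge]
      rfl
    · intro C hC
      rcases Multiset.mem_cons.1 hC with rfl | hC
      · simp
      · exact h1 C hC
  | iso h e ih =>
    obtain ⟨m, hm, h1⟩ := ih
    exact ⟨m, hm.iso e, h1⟩

theorem GMBuild.isMelonic {d : ℕ} {B : ColoredGraph (Fin d)} {m : Multiset (Finset (Fin d))}
    (h : GMBuild B m) (hm : ∀ C ∈ m, C.card = 1) : IsMelonic B := by
  classical
  induction h with
  | two => exact IsMelonic.two
  | @white B m h C hC u ih =>
    obtain ⟨c, rfl⟩ := Finset.card_eq_one.1 (hm C (Multiset.mem_cons_self _ _))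
    refine IsMelonic.iso (IsMelonic.dipole (ih fun D hD => hm D (Multiset.mem_cons_of_mem hD)) c u)
      ⟨Equiv.refl (Option B.W), Equiv.refl (Option B.K), fun c' w => ?_⟩
    rw [B.insertWhite_edge, B.insertDipole_edge]
    rfl
  | @black B m h C hC u ih =>
    obtain ⟨c, rfl⟩ := Finset.card_eq_one.1 (hm C (Multiset.mem_cons_self _ _))
    -- An insertion with `C = {c}` at the black vertex `u` is a dipole on the edge of colour `c` at
    -- `u`, described from its white end.
    refine IsMelonic.iso (IsMelonic.dipole (ih fun D hD => hm D (Multiset.mem_cons_of_mem hD)) c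
      ((B.edge c).symm u))
      ⟨Equiv.refl (Option B.W), Equiv.refl (Option B.K), fun c' (w : Option B.W) => ?_⟩
    rw [B.insertBlack_edge, B.insertDipole_edge]
    change (B.edge c').optionCongr (swapIn {c} (some ((B.edge c).symm u)) none c' w) =
      swapIn {c} (some u) none c' ((B.edge c').optionCongr w)
    by_cases hc : c' = c
    · subst hc
      rw [swapIn_of_mem (Finset.mem_singleton_self _), swapIn_of_mem (Finset.mem_singleton_self _),
        (B.edge c').optionCongr.injective.map_swap]
      simp
    · rw [swapIn_of_notMem (mt Finset.mem_singleton.1 hc),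
        swapIn_of_notMem (mt Finset.mem_singleton.1 hc)]
      rfl
  | iso h e ih => exact (ih hm).iso e

/-! ## Matchings between the vertices of a family of coloured graphs -/

section

variable {d : ℕ} {P : Type} {A A' : P → Type}

/-- The matchings of the graph obtained from the disjoint union of a family by adding the edges `σ`
of colour `0`. -/
def withZero (e : ∀ p, Fin d → A p ≃ A' p) (σ : (Σ p, A p) ≃ (Σ p, A' p)) :
    Fin (d + 1) → ((Σ p, A p) ≃ (Σ p, A' p)) :=
  Fin.cons (α := fun _ => (Σ p, A p) ≃ (Σ p, A' p)) σ
    fun c => Equiv.sigmaCongrRight fun p => e p c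

/-- The relation between the members of the family generated by a matching. -/
def blockSetoid (σ : (Σ p, A p) ≃ (Σ p, A' p)) : Setoid P :=
  Relation.EqvGen.setoid fun p q => ∃ w, p = Sigma.fst w ∧ q = Sigma.fst (σ w)

variable {e : ∀ p, Fin d → A p ≃ A' p} {σ : (Σ p, A p) ≃ (Σ p, A' p)}

theorem blockSetoid_fst_of_colorSetoid {x y : Σ p, A p}
    (hxy : colorSetoid (withZero e σ) Set.univ x y) : blockSetoid σ x.1 y.1 := by
  have key : ∀ c x, blockSetoid σ x.1 (withZero e σ c x).1 := by
    intro c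
    refine Fin.cases ?_ ?_ c
    · exact fun x => Relation.EqvGen.rel _ _ ⟨x, rfl, rfl⟩
    · exact fun c x => Setoid.refl' _ _
  refine (colorSetoid_le (r := (blockSetoid σ).comap Sigma.fst) ?_) hxy
  intro c _ c' _ x y hx
  rw [Setoid.comap_rel]
  refine Setoid.trans' _ (key c x) ?_
  rw [hx]
  exact Setoid.symm' _ (key c' y)

theorem colorSetoid_withZero_of_block {p : P} {w w' : A p}
    (h : colorSetoid (e p) Set.univ w w') :
    colorSetoid (withZero e σ) Set.univ ⟨p, w⟩ ⟨p, w'⟩ := by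
  refine (colorSetoid_le
    (r := (colorSetoid (withZero e σ) Set.univ).comap fun w : A p => ⟨p, w⟩) ?_) h
  intro c _ c' _ x y hx
  refine colorSetoid_of_eq (c := c.succ) (c' := c'.succ) (Set.mem_univ _) (Set.mem_univ _) ?_
  simp [withZero, hx]

/-- When all the vertices of a block are connected to each other, connectedness is decided by the
relation between the blocks. -/
theorem connected_iff_blockSetoid (hd : 0 < d) (hne : ∀ p, Nonempty (A p))
    (hblock : ∀ p (w w' : A p), colorSetoid (withZero e σ) Set.univ ⟨p, w⟩ ⟨p, w'⟩) :
    (Nonempty (Σ p, A p) ∧ ∀ x y, colorSetoid (withZero e σ) Set.univ x y) ↔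
      Nonempty P ∧ ∀ p q, blockSetoid σ p q := by
  constructor
  · rintro ⟨⟨w⟩, h⟩
    exact ⟨⟨w.1⟩, fun p q => blockSetoid_fst_of_colorSetoid (h ⟨p, Classical.choice (hne p)⟩
      ⟨q, Classical.choice (hne q)⟩)⟩
  · rintro ⟨⟨p⟩, h⟩
    refine ⟨⟨⟨p, Classical.choice (hne p)⟩⟩, ?_⟩
    have key : blockSetoid σ ≤ (colorSetoid (withZero e σ) Set.univ).comap
        (fun p => ⟨p, Classical.choice (hne p)⟩) := by
      refine eqvGen_setoid_le ?_
      rintro p' _ ⟨⟨_, w⟩, rfl, rfl⟩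
      rw [Setoid.comap_rel]
      refine Setoid.trans' _ (hblock p' _ w) ?_
      generalize hσ : σ ⟨p', w⟩ = v
      obtain ⟨q, v⟩ := v
      refine Setoid.trans' _ ?_ (hblock q ((e q ⟨0, hd⟩).symm v) _)
      refine colorSetoid_of_eq (c := 0) (c' := Fin.succ ⟨0, hd⟩) (Set.mem_univ _)
        (Set.mem_univ _) ?_
      change σ ⟨p', w⟩ = (Equiv.sigmaCongrRight fun p => e p ⟨0, hd⟩) ⟨q, _⟩
      rw [hσ]
      simp
    rintro ⟨p, w⟩ ⟨q, w'⟩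
    exact Setoid.trans' _ (hblock p w _) (Setoid.trans' _ (key (h p q)) (hblock q _ w'))

/-- The total number of cycles with colours `0` and `c`. -/
noncomputable def zeroCycles (e : ∀ p, Fin d → A p ≃ A' p) (σ : (Σ p, A p) ≃ (Σ p, A' p)) : ℕ :=
  ∑ c, Equiv.Perm.numOrbits ((Equiv.sigmaCongrRight fun p => e p c).trans σ.symm)

variable [Finite P] [∀ p, Finite (A p)] {m : P → Multiset (Finset (Fin d))}

/-- `SwapGen.numOrbits_upper_bound` with `π = σ⁻¹ ∘ E`: connectedness leaves the partition with a
single class, so its contribution is `d`. -/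
theorem zeroCycles_upper_bound {E : ∀ p, A p ≃ A' p} {f : ∀ p, Fin d → Equiv.Perm (A p)}
    (hf : ∀ p, SwapGen (f p) (m p)) (he : ∀ p c, e p c = (f p c).trans (E p))
    (hm : ∀ p, ∀ C ∈ m p, 2 * C.card ≤ d)
    (hσ : Nonempty (Σ p, A p) ∧ ∀ x y, colorSetoid (withZero e σ) Set.univ x y) :
    zeroCycles e σ + ((∑ᶠ p, m p).map Finset.card).sum ≤
      d + d * Multiset.card (∑ᶠ p, m p) := by
  have hM : ∀ C ∈ ∑ᶠ p, m p, 2 * C.card ≤ d := by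
    have := Fintype.ofFinite P
    rw [finsum_eq_sum_of_fintype]
    intro C hC
    obtain ⟨p, -, hp⟩ := Multiset.mem_sum.1 hC
    exact hm p C hp
  obtain ⟨r, h1, h3⟩ := (SwapGen.sigma hf).numOrbits_upper_bound hM
    ((Equiv.sigmaCongrRight E).trans σ.symm)
  have hπ : ∀ c, ((Equiv.sigmaCongrRight fun p => e p c).trans σ.symm) =
      ((Equiv.sigmaCongrRight E).trans σ.symm * (Equiv.sigmaCongrRight fun p => f p c) :
        Equiv.Perm (Σ p, A p)) := by
    intro c
    ext1 ⟨p, x⟩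
    simp [he]
  -- Each black vertex is identified with its white neighbour of colour 0. Edges of colour 0 then
  -- become trivial, and the other colours act by the permutations whose cycles `r` contains.
  have hr : colorSetoid (withZero e σ) Set.univ ≤ r := by
    have key : ∀ c x, r x (σ.symm (withZero e σ c x)) := by
      intro c
      refine Fin.cases ?_ ?_ c
      · intro x
        simp [withZero]
      · intro c x
        refine h1 c ⟨1, ?_⟩
        rw [← hπ c]
        simp [withZero]
    refine colorSetoid_le fun c _ c' _ x y hx => ?_
    refine r.trans (key c x) ?_
    rw [hx]
    exact r.symm (key c' y)
  have h4 : Nat.card (Quotient r) = 1 :=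
    Setoid.card_quotient_eq_one_iff.2 ⟨hσ.1, fun x y => hr (hσ.2 x y)⟩
  rw [h4] at h3
  simp only [zeroCycles, hπ]
  linarith

/-- Joining one representative of every block along a cycle gives a connected graph with the
maximal number of cycles. -/
theorem exists_zeroCycles_lower_bound [Nonempty P] (hd : 0 < d) {E : ∀ p, A p ≃ A' p}
    {f : ∀ p, Fin d → Equiv.Perm (A p)}
    (hf : ∀ p, SwapGen (f p) (m p)) (he : ∀ p c, e p c = (f p c).trans (E p))
    (hcon : ∀ p, Nonempty (A p) ∧ ∀ x y, colorSetoid (e p) Set.univ x y)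
    (hcard : ∀ p, Nat.card (A p) = Multiset.card (m p) + 1) :
    ∃ σ : (Σ p, A p) ≃ (Σ p, A' p),
      (Nonempty (Σ p, A p) ∧ ∀ x y, colorSetoid (withZero e σ) Set.univ x y) ∧
      d + d * Multiset.card (∑ᶠ p, m p) ≤
        zeroCycles e σ + ((∑ᶠ p, m p).map Finset.card).sum := by
  classical
  have := Fintype.ofFinite P
  let ι : P ↪ Σ p, A p := ⟨fun p => ⟨p, Classical.choice (hcon p).1⟩, fun p q h => congrArg Sigma.fst h⟩
  obtain ⟨ρ, hρ, -⟩ := (Finset.univ : Finset P).exists_cycleOn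
  have hρ' : ∀ p q, Equiv.Perm.SameCycle ρ p q := fun p q => hρ.2 (by simp) (by simp)
  -- One cycle through the chosen representatives; every other vertex is a fixed point, hence an
  -- orbit of its own.
  let π : Equiv.Perm (Σ p, A p) := ρ.viaEmbedding ι
  have hπι : ∀ p, π (ι p) = ι (ρ p) := fun p => Equiv.Perm.viaEmbedding_apply _ _ _
  have hπn : ∀ x, x ∉ Set.range ι → π x = x :=
    fun x hx => Equiv.Perm.viaEmbedding_apply_of_notMem _ _ _ hx
  -- Chosen so that `σ⁻¹ ∘ E = π`.
  let σ : (Σ p, A p) ≃ (Σ p, A' p) := Equiv.trans π.symm (Equiv.sigmaCongrRight E)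
  have hσ : ∀ c, ((Equiv.sigmaCongrRight fun p => e p c).trans σ.symm) =
      (π * (Equiv.sigmaCongrRight fun p => f p c) : Equiv.Perm (Σ p, A p)) := by
    intro c
    ext1 ⟨p, x⟩
    simp [he, σ, Equiv.symm_apply_eq]
  refine ⟨σ, ?_, ?_⟩
  · rw [connected_iff_blockSetoid hd (fun p => (hcon p).1)
      (fun p w w' => colorSetoid_withZero_of_block ((hcon p).2 w w'))]
    refine ⟨inferInstance, fun p q => ?_⟩
    refine (Equiv.Perm.sameCycle_setoid_le (r := blockSetoid σ) fun p => ?_) (hρ' p q)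
    refine Setoid.symm' _ (Relation.EqvGen.rel _ _ ⟨ι (ρ p), rfl, ?_⟩)
    have : π.symm (ι (ρ p)) = ι p := by rw [Equiv.symm_apply_eq, hπι]
    simp only [σ, Equiv.trans_apply, this]
    rfl
  -- The orbits counted are that of a representative and the fixed points. By `hcard`, block `p` has
  -- `card (m p)` vertices besides its representative.
  · have hπ : 1 + Multiset.card (∑ᶠ p, m p) ≤ π.numOrbits := by
      have h1 : Nat.card (Option (Σ p, {w : A p // w ≠ Classical.choice (hcon p).1})) =
          1 + Multiset.card (∑ᶠ p, m p) := by
        have h2 : ∀ p, Nat.card {w : A p // w ≠ Classical.choice (hcon p).1} =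
            Multiset.card (m p) := by
          intro p
          have h3 := Nat.card_congr (Equiv.optionSubtypeNe (Classical.choice (hcon p).1))
          rw [Finite.card_option, hcard] at h3
          omega
        rw [Finite.card_option, Nat.card_sigma, finsum_eq_sum_of_fintype,
          Multiset.card_sum]
        simp only [h2]
        ring
      rw [← h1]
      obtain ⟨p₀⟩ := ‹Nonempty P›
      have hfix : ∀ y : Σ p, {w : A p // w ≠ Classical.choice (hcon p).1},
          (⟨y.1, y.2.1⟩ : Σ p, A p) ∉ Set.range ι := by
        rintro ⟨p, w, hw⟩ ⟨q, hq⟩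
        obtain rfl : q = p := congrArg Sigma.fst hq
        exact hw (eq_of_heq (Sigma.mk.inj hq).2).symm
      have hsame : ∀ x y, x ∉ Set.range ι → Equiv.Perm.SameCycle π x y → x = y := by
        rintro x y hx ⟨i, rfl⟩
        exact (Equiv.Perm.zpow_apply_eq_self_of_apply_eq_self (hπn x hx) i).symm
      refine Nat.card_le_card_of_injective (fun o => Quotient.mk (Equiv.Perm.SameCycle.setoid π)
        (o.elim (ι p₀) fun y => ⟨y.1, y.2.1⟩)) ?_
      rintro (_ | x) (_ | y) hxy
      · rfl
      · have h' := Quotient.exact hxy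
        exact absurd ⟨p₀, (hsame _ _ (hfix y) (Setoid.symm' _ h')).symm⟩ (hfix y)
      · have h' := Quotient.exact hxy
        exact absurd ⟨p₀, (hsame _ _ (hfix x) h').symm⟩ (hfix x)
      · have h' := hsame _ _ (hfix x) (Quotient.exact hxy)
        obtain ⟨p, x, hx⟩ := x
        obtain ⟨q, y, hy⟩ := y
        simp only [Option.elim, Sigma.mk.injEq] at h'
        obtain ⟨rfl, h'⟩ := h'
        obtain rfl := eq_of_heq h'
        rfl
    have h2 := (SwapGen.sigma hf).numOrbits_lower_bound π
    simp only [zeroCycles, hσ]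
    have h3 := Nat.mul_le_mul_left d hπ
    linarith

end

/-! ## The critical scaling -/

section

variable {d : ℕ} {R : Type} [Fintype R] {B : R → ColoredGraph (Fin d)} {b : R → ℕ}
  {m : R → Multiset (Finset (Fin d))}

theorem Wick.connected_iff (σ : Wick B b) : σ.graph.Connected ↔
    Nonempty (Σ p : (Σ r, Fin (b r)), (B p.1).W) ∧
      ∀ x y, colorSetoid (withZero (fun p : (Σ r, Fin (b r)) => (B p.1).edge) σ) Set.univ x y :=
  ColoredGraph.connected_iff _

theorem Wick.totalCycles_eq (σ : Wick B b) : σ.graph.totalCycles =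
    zeroCycles (fun p : (Σ r, Fin (b r)) => (B p.1).edge) σ := by
  simp only [ColoredGraph.totalCycles, ColoredGraph.numCycles_eq]
  rfl

theorem finsum_copies (m : R → Multiset (Finset (Fin d))) :
    ∑ᶠ p : (Σ r, Fin (b r)), m p.1 = ∑ r, b r • m r := by
  rw [finsum_eq_sum_of_fintype, Fintype.sum_sigma]
  simp

theorem sum_map_card_eq (m : Multiset (Finset (Fin d))) :
    ∑ C : Finset (Fin d), (C.card : ℝ) * (m.count C : ℝ) = ((m.map Finset.card).sum : ℕ) := by
  rw [Finset.sum_multiset_map_count, ← Finset.sum_subset (Finset.subset_univ m.toFinset)]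
  · push_cast
    exact Finset.sum_congr rfl fun C _ => by rw [smul_eq_mul, Nat.cast_mul, mul_comm]
  · intro C _ hC
    rw [Multiset.mem_toFinset] at hC
    simp [Multiset.count_eq_zero.2 hC]

/-- Half of `V - 2` is the number of insertions. In this form the coefficient matches the two sides
of the cycle bounds. -/
theorem GMBuild.scalingCoefficient_eq {B : ColoredGraph (Fin d)} {m : Multiset (Finset (Fin d))}
    (h : GMBuild B m) :
    scalingCoefficient B m = ((m.map Finset.card).sum : ℕ) - (d : ℝ) * Multiset.card m := by
  rw [scalingCoefficient, h.numVertices_eq, sum_map_card_eq]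
  push_cast
  ring

theorem sum_scalingCoefficient (hB : ∀ r, GMBuild (B r) (m r)) :
    ∑ r, scalingCoefficient (B r) (m r) * (b r : ℝ) =
      (((∑ᶠ p : (Σ r, Fin (b r)), m p.1).map Finset.card).sum : ℕ) -
        (d : ℝ) * Multiset.card (∑ᶠ p : (Σ r, Fin (b r)), m p.1) := by
  have h1 : ((∑ r, b r • m r).map Finset.card).sum = ∑ r, b r * ((m r).map Finset.card).sum := by
    rw [← Multiset.coe_mapAddMonoidHom, map_sum, ← Multiset.coe_sumAddMonoidHom, map_sum]
    simp [Multiset.map_nsmul, Multiset.sum_nsmul]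
  rw [finsum_copies, h1, Multiset.card_sum, Nat.cast_sum, Nat.cast_sum, Finset.mul_sum,
    ← Finset.sum_sub_distrib]
  refine Finset.sum_congr rfl fun r _ => ?_
  rw [(hB r).scalingCoefficient_eq, Multiset.card_nsmul]
  push_cast
  ring

theorem amplitudeDegree_le (hB : ∀ r, GMBuild (B r) (m r)) {σ : Wick B b}
    (hσ : σ ∈ feynmanGraphs B b) :
    amplitudeDegree (fun r => scalingCoefficient (B r) (m r)) b σ.graph ≤ d := by
  choose E f hf he using fun r => (hB r).exists_swapGen
  have h := zeroCycles_upper_bound (P := Σ r, Fin (b r)) (e := fun p => (B p.1).edge)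
    (fun p => hf p.1) (fun p => he p.1)
    (fun p C hC => ((hB p.1).admissible C hC).2.1) (σ.connected_iff.1 hσ)
  rw [amplitudeDegree, sum_scalingCoefficient hB, Wick.totalCycles_eq]
  have h' : ((_ : ℕ) : ℝ) ≤ ((_ : ℕ) : ℝ) := Nat.cast_le.2 h
  push_cast at h' ⊢
  linarith

theorem exists_amplitudeDegree_eq (hd : 0 < d) (hB : ∀ r, GMBuild (B r) (m r))
    (hb : Nonempty (Σ r, Fin (b r))) :
    ∃ σ ∈ feynmanGraphs B b,
      amplitudeDegree (fun r => scalingCoefficient (B r) (m r)) b σ.graph = d := by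
  choose E f hf he using fun r => (hB r).exists_swapGen
  obtain ⟨(σ : Wick B b), hσ, h⟩ := exists_zeroCycles_lower_bound (P := Σ r, Fin (b r))
    (e := fun p => (B p.1).edge) hd (fun p => hf p.1) (fun p => he p.1)
    (fun p => (hB p.1).connected hd) (fun p => (hB p.1).card_W)
  have hσ' : σ ∈ feynmanGraphs B b := (Wick.connected_iff (B := B) (b := b) σ).2 hσ
  refine ⟨σ, hσ', le_antisymm (amplitudeDegree_le hB hσ') ?_⟩
  rw [amplitudeDegree, sum_scalingCoefficient hB, Wick.totalCycles_eq]
  have h' : ((_ : ℕ) : ℝ) ≤ ((_ : ℕ) : ℝ) := Nat.cast_le.2 h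
  push_cast at h' ⊢
  linarith

theorem nonempty_copies_of_mem {σ : Wick B b} (hσ : σ ∈ feynmanGraphs B b) :
    Nonempty (Σ r, Fin (b r)) :=
  let ⟨x⟩ := (σ.connected_iff.1 hσ).1
  ⟨x.1⟩

/-- The dominant graphs are those of degree `d`. -/
theorem mem_maxGraphs_iff (hd : 0 < d) (hB : ∀ r, GMBuild (B r) (m r)) {σ : Wick B b} :
    σ ∈ maxGraphs B b ↔ σ ∈ feynmanGraphs B b ∧
      amplitudeDegree (fun r => scalingCoefficient (B r) (m r)) b σ.graph = d := by
  constructor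
  · rintro ⟨hσ, hmax⟩
    refine ⟨hσ, le_antisymm (amplitudeDegree_le hB hσ) ?_⟩
    obtain ⟨τ, hτ, h⟩ := exists_amplitudeDegree_eq hd hB (nonempty_copies_of_mem hσ)
    rw [← h]
    exact add_le_add_left (Nat.cast_le.2 (hmax τ hτ)) _
  · rintro ⟨hσ, h⟩
    refine ⟨hσ, fun τ hτ => ?_⟩
    have h1 := amplitudeDegree_le hB hτ
    rw [← h] at h1
    exact Nat.cast_le.1 (le_of_add_le_add_right h1)

theorem leadingGraphs_eq_maxGraphs (hd : 0 < d) (hB : ∀ r, GMBuild (B r) (m r)) (b : R → ℕ) :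
    leadingGraphs B (fun r => scalingCoefficient (B r) (m r)) b = maxGraphs B b := by
  ext σ
  rw [mem_maxGraphs_iff hd hB]
  constructor
  · rintro ⟨hσ, hmax⟩
    refine ⟨hσ, le_antisymm (amplitudeDegree_le hB hσ) ?_⟩
    obtain ⟨τ, hτ, h⟩ := exists_amplitudeDegree_eq hd hB (nonempty_copies_of_mem hσ)
    rw [← h]
    exact hmax b τ hτ
  · rintro ⟨hσ, h⟩
    refine ⟨hσ, fun b' τ hτ => ?_⟩
    rw [h]
    exact amplitudeDegree_le hB hτ

/-! ### Uniqueness of the scaling. -/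

theorem amplitudeDegree_eq_add (s s' : R → ℝ) (b : R → ℕ) (X : ColoredGraph (Fin (d + 1))) :
    amplitudeDegree s b X = amplitudeDegree s' b X + ∑ r, (s r - s' r) * (b r : ℝ) := by
  simp only [amplitudeDegree, sub_mul, Finset.sum_sub_distrib]
  ring

theorem nonempty_copies_of_lt {R : Type} {b : R → ℕ} {r : R} (h : 0 < b r) : Nonempty (Σ r, Fin (b r)) :=
  ⟨⟨r, ⟨0, h⟩⟩⟩

theorem le_scalingCoefficient_of_hasLargeNLimit (hd : 0 < d) (hB : ∀ r, GMBuild (B r) (m r))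
    {s : R → ℝ} (h : HasLargeNLimit B s) (r : R) : s r ≤ scalingCoefficient (B r) (m r) := by
  classical
  obtain ⟨q, hq⟩ := h
  by_contra! hlt
  obtain ⟨n, hn⟩ := exists_nat_gt ((q - d) / (s r - scalingCoefficient (B r) (m r)))
  rw [div_lt_iff₀ (sub_pos.2 hlt)] at hn
  -- With only bubbles `B r`, an optimal graph has degree `d + (s r - s_r*)(n + 1)`, which exceeds
  -- `q` for this `n`.
  let b : R → ℕ := Pi.single r (n + 1)
  obtain ⟨σ, hσ, h⟩ := exists_amplitudeDegree_eq (b := b) hd hB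
    (nonempty_copies_of_lt (r := r) (by simp [b]))
  have h1 := hq b σ hσ
  rw [amplitudeDegree_eq_add s (fun r => scalingCoefficient (B r) (m r)), h,
    Finset.sum_eq_single r (by intro r' _ h; simp [b, h]) (by simp)] at h1
  simp only [b, Pi.single_eq_same] at h1
  push_cast at h1
  nlinarith

theorem hasNontrivialLargeNLimit_iff (hd : 0 < d) (hB : ∀ r, GMBuild (B r) (m r)) (s : R → ℝ) :
    HasNontrivialLargeNLimit B s ↔ ∀ r, s r = scalingCoefficient (B r) (m r) := by
  classical
  constructor
  · rintro ⟨hlim, hnt⟩ r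
    have hle := le_scalingCoefficient_of_hasLargeNLimit hd hB hlim
    refine le_antisymm (hle r) ?_
    by_contra! hlt
    obtain ⟨b₀, hb₀, σ₀, hσ₀⟩ := hnt r 0
    -- `σ₀` is a reference leading graph. A graph with at least `n` bubbles `B r` has degree at most
    -- `d - (s_r* - s r) n`, which is below the degree of `σ₀`.
    obtain ⟨n, hn⟩ := exists_nat_gt ((d - amplitudeDegree s b₀ σ₀.graph) /
      (scalingCoefficient (B r) (m r) - s r))
    rw [div_lt_iff₀ (sub_pos.2 hlt)] at hn
    obtain ⟨b, hb, σ, hσ⟩ := hnt r n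
    have h1 := hσ.2 b₀ σ₀ hσ₀.1
    rw [amplitudeDegree_eq_add s (fun r => scalingCoefficient (B r) (m r)) b] at h1
    have h2 := amplitudeDegree_le hB hσ.1
    -- The other coefficients do not exceed their critical values, so they can only lower the degree
    -- further.
    have h3 : ∑ r', (s r' - scalingCoefficient (B r') (m r')) * (b r' : ℝ) ≤
        (s r - scalingCoefficient (B r) (m r)) * (b r : ℝ) := by
      rw [← Finset.add_sum_erase _ _ (Finset.mem_univ r)]
      have : ∑ r' ∈ Finset.univ.erase r,
          (s r' - scalingCoefficient (B r') (m r')) * (b r' : ℝ) ≤ 0 :=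
        Finset.sum_nonpos fun r' _ =>
          mul_nonpos_of_nonpos_of_nonneg (sub_nonpos.2 (hle r')) (Nat.cast_nonneg _)
      linarith
    have h4 : (n : ℝ) ≤ b r := Nat.cast_le.2 hb
    nlinarith
  · intro h
    obtain rfl : s = fun r => scalingCoefficient (B r) (m r) := funext h
    refine ⟨⟨d, fun b σ hσ => amplitudeDegree_le hB hσ⟩, fun r n => ?_⟩
    refine ⟨Pi.single r (n + 1), by simp, ?_⟩
    obtain ⟨σ, hσ, h⟩ := exists_amplitudeDegree_eq (b := Pi.single r (n + 1)) hd hB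
      (nonempty_copies_of_lt (r := r) (by simp))
    exact ⟨σ, by rw [leadingGraphs_eq_maxGraphs hd hB, mem_maxGraphs_iff hd hB]; exact ⟨hσ, h⟩⟩

/-! ### Independence of the construction, and melonic bubbles. -/

/-- The critical scaling does not depend on the construction of the bubble. -/
theorem GMBuild.scalingCoefficient_unique (hd : 0 < d) {B : ColoredGraph (Fin d)}
    {m m' : Multiset (Finset (Fin d))} (h : GMBuild B m) (h' : GMBuild B m') :
    scalingCoefficient B m = scalingCoefficient B m' :=
  -- In the model with the single interaction `B`, the scaling computed from `m` has a non-trivial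
  -- limit, and is therefore also the one computed from `m'`.
  (hasNontrivialLargeNLimit_iff (R := Unit) hd (fun _ => h')
    fun _ => scalingCoefficient B m).1
    ((hasNontrivialLargeNLimit_iff (R := Unit) hd (fun _ => h) _).2 fun _ => rfl) ()

/-- The given `m` may come from any construction, so it is first replaced by one with `|C| = 1`
throughout. -/
theorem IsMelonic.scalingCoefficient_eq (hd : 3 ≤ d) {B : ColoredGraph (Fin d)}
    {m : Multiset (Finset (Fin d))} (h : GMBuild B m) (hB : IsMelonic B) :
    scalingCoefficient B m = -((d : ℝ) - 1) * (B.numVertices - 2) / 2 := by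
  obtain ⟨m', h', hm'⟩ := hB.exists_gmBuild hd
  rw [h.scalingCoefficient_unique (by omega) h', h'.scalingCoefficient_eq, h'.numVertices_eq,
    Multiset.map_congr rfl hm']
  simp
  ring

theorem scalingCoefficient_gt_of_not_isMelonic {B : ColoredGraph (Fin d)}
    {m : Multiset (Finset (Fin d))} (h : GMBuild B m) (hB : ¬ IsMelonic B) :
    scalingCoefficient B m > -((d : ℝ) - 1) * (B.numVertices - 2) / 2 := by
  have h1 : Multiset.card m < (m.map Finset.card).sum := by
    have hle : ∀ C ∈ m, 1 ≤ C.card := fun C hC => (h.admissible C hC).1.card_pos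
    have hex : ∃ C ∈ m, 1 < C.card := by
      by_contra! hall
      exact hB (h.isMelonic fun C hC => le_antisymm (hall C hC) (hle C hC))
    have := Multiset.sum_lt_sum (f := fun _ => 1) hle hex
    simpa using this
  have h2 : ((Multiset.card m : ℕ) : ℝ) < ((m.map Finset.card).sum : ℕ) := Nat.cast_lt.2 h1
  rw [h.scalingCoefficient_eq, h.numVertices_eq]
  push_cast at h2 ⊢
  linarith

end

/-! ## Colour sets are determined by numbers of components -/

/-- A set `C` is counted at `T = C` if it contains `S`, and at `T = Cᶜ` if it is disjoint from `S`.
Both cannot happen for nonempty `S`. -/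
theorem countP_noncrossing_eq_sum {d : ℕ} (m : Multiset (Finset (Fin d))) {S : Finset (Fin d)}
    (hS : S.Nonempty) :
    m.countP (fun C => S ⊆ C ∨ Disjoint S C) =
      ∑ T ∈ Finset.univ.filter (S ⊆ ·), (m.count T + m.count Tᶜ) := by
  induction m using Multiset.induction_on with
  | empty => simp
  | cons C m ih =>
    simp only [Multiset.countP_cons, Multiset.count_cons, ih, Finset.sum_add_distrib]
    have h1 : ∑ T ∈ Finset.univ.filter (S ⊆ ·), (if T = C then 1 else 0) =
        if S ⊆ C then 1 else 0 := by
      rw [Finset.sum_ite_eq']; simp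
    have h2 : ∑ T ∈ Finset.univ.filter (S ⊆ ·), (if Tᶜ = C then 1 else 0) =
        if Disjoint S C then 1 else 0 := by
      have : ∀ T : Finset (Fin d), Tᶜ = C ↔ T = Cᶜ := fun T => compl_eq_comm.trans eq_comm
      simp only [this]
      rw [Finset.sum_ite_eq']; simp [Finset.subset_compl_iff_disjoint_right]
    rw [h1, h2]
    have h3 : ¬ (S ⊆ C ∧ Disjoint S C) := by
      rintro ⟨h, h'⟩
      obtain ⟨x, hx⟩ := hS
      exact Finset.disjoint_left.1 h' hx (h hx)
    by_cases ha : S ⊆ C <;> by_cases hb : Disjoint S C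
    · exact absurd ⟨ha, hb⟩ h3
    all_goals simp only [ha, hb, if_true, if_false, or_true, or_false]
    all_goals omega

theorem AdmissibleSet.not_compl {d : ℕ} {C : Finset (Fin d)} (h : AdmissibleSet C) :
    ¬ AdmissibleSet Cᶜ := by
  intro h'
  have h1 := h.2.1
  have h2 := h'.2.1
  rw [Finset.card_compl, Fintype.card_fin] at h2
  obtain ⟨c, hc, hc0⟩ := h.2.2 (by omega)
  obtain ⟨c', hc', hc0'⟩ := h'.2.2 (by rw [Finset.card_compl, Fintype.card_fin]; omega)
  obtain rfl : c = c' := Fin.ext (hc0.trans hc0'.symm)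
  exact Finset.mem_compl.1 hc' hc

/-- Möbius inversion from large `S` to small: once the strict supersets are known, the sum gives the
joint multiplicity of `S` and `Sᶜ`. Admissibility allows at most one of a set and its complement,
which separates the two. -/
theorem eq_of_countP_noncrossing_eq {d : ℕ} {m m' : Multiset (Finset (Fin d))}
    (hm : ∀ C ∈ m, AdmissibleSet C) (hm' : ∀ C ∈ m', AdmissibleSet C)
    (h : ∀ S : Finset (Fin d), S.Nonempty → m.countP (fun C => S ⊆ C ∨ Disjoint S C) =
      m'.countP (fun C => S ⊆ C ∨ Disjoint S C)) : m = m' := by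
  have key : ∀ (n : ℕ) (S : Finset (Fin d)), Sᶜ.card = n → S.Nonempty →
      m.count S + m.count Sᶜ = m'.count S + m'.count Sᶜ := by
    intro n
    induction n using Nat.strong_induction_on with
    | _ n ih =>
      intro S hn hS
      have h1 := h S hS
      rw [countP_noncrossing_eq_sum m hS, countP_noncrossing_eq_sum m' hS,
        ← Finset.add_sum_erase _ (fun T => m.count T + m.count Tᶜ) (a := S) (by simp),
        ← Finset.add_sum_erase _ (fun T => m'.count T + m'.count Tᶜ) (a := S) (by simp)] at h1
      have h2 : ∀ T ∈ (Finset.univ.filter (S ⊆ ·)).erase S,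
          m.count T + m.count Tᶜ = m'.count T + m'.count Tᶜ := by
        intro T hT
        rw [Finset.mem_erase, Finset.mem_filter] at hT
        have hlt : S ⊂ T := Finset.ssubset_iff_subset_ne.2 ⟨hT.2.2, hT.1.symm⟩
        refine ih _ ?_ T rfl (hS.mono hT.2.2)
        rw [← hn]
        exact Finset.card_lt_card (compl_lt_compl_iff_lt.2 hlt)
      rw [Finset.sum_congr rfl h2] at h1
      exact Nat.add_right_cancel h1
  ext C
  by_cases hC : AdmissibleSet C
  · have h0 : ∀ m : Multiset (Finset (Fin d)), (∀ C ∈ m, AdmissibleSet C) → m.count Cᶜ = 0 :=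
      fun m hm => Multiset.count_eq_zero.2 fun h => hC.not_compl (hm _ h)
    simpa [h0 m hm, h0 m' hm'] using key _ C rfl hC.1
  · rw [Multiset.count_eq_zero.2 fun h => hC (hm C h), Multiset.count_eq_zero.2 fun h => hC (hm' C h)]

/-! ## Contraction of lines -/

section

variable {W K : Type}

theorem contractLine_eq [DecidableEq W] (e : W ≃ K) (w : W) (k : K) :
    contractLine e (w, k) = (Equiv.swap w (e.symm k)).trans e := by
  classical
  ext1 x
  unfold contractLine
  simp only [Equiv.trans_apply]
  rw [e.injective.map_swap, e.apply_symm_apply, Equiv.swap_comm]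

theorem contractLine_apply_left (e : W ≃ K) (w : W) (k : K) : contractLine e (w, k) w = k := by
  classical
  simp [contractLine_eq]

theorem contractLine_apply_symm (e : W ≃ K) (w : W) (k : K) :
    contractLine e (w, k) (e.symm k) = e w := by
  classical
  simp [contractLine_eq]

theorem contractLine_apply_of_ne {e : W ≃ K} {w x : W} {k : K} (h1 : x ≠ w) (h2 : x ≠ e.symm k) :
    contractLine e (w, k) x = e x := by
  classical
  simp [contractLine_eq, Equiv.swap_apply_of_ne_of_ne h1 h2]

/-- Contracting a line of `σ` makes `w` a fixed point. Undoing the contraction is a transposition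
joining this fixed point to another orbit; `he` says that the two exchanged vertices differ. -/
theorem numOrbits_contractLine [Finite W] {e σ : W ≃ K} {w : W} {k : K} (hσ : σ w = k)
    (he : e w ≠ k) :
    Equiv.Perm.numOrbits ((contractLine e (w, k)).trans σ.symm) =
      Equiv.Perm.numOrbits (e.trans σ.symm) + 1 := by
  classical
  have hu : e.symm k ≠ w := fun h => he (by rw [← h, e.apply_symm_apply])
  have h1 : (e.trans σ.symm : Equiv.Perm W) =
      ((contractLine e (w, k)).trans σ.symm : Equiv.Perm W) * Equiv.swap w (e.symm k) := by
    ext1 x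
    simp [contractLine_eq]
  rw [h1]
  apply Equiv.Perm.numOrbits_mul_swap_of_not_sameCycle
  rintro ⟨i, hi⟩
  rw [Equiv.Perm.zpow_apply_eq_self_of_apply_eq_self] at hi
  · exact hu hi.symm
  · rw [Equiv.trans_apply, contractLine_apply_left, ← hσ, σ.symm_apply_apply]

variable {ι : Type} {e : ι → W ≃ K} {S : Set ι}

/-- The neighbours of `k` lose their common vertex `k` but inherit the neighbours of `w`. The cycle
through `w` with colours `c`, `c'`, cut at `w`, is a path between those, and it is untouched because
it lies in another component than `k`. -/
theorem colorSetoid_contractLine_neighbours [Finite W] {w : W} {k : K}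
    (h : ∀ c ∈ S, ¬ colorSetoid e S w ((e c).symm k)) {c c' : ι} (hc : c ∈ S) (hc' : c' ∈ S) :
    colorSetoid (fun c => contractLine (e c) (w, k)) S ((e c).symm k) ((e c').symm k) := by
  set r := colorSetoid (fun c => contractLine (e c) (w, k)) S with hr
  set ρ : Equiv.Perm W := (e c).trans (e c').symm with hρ
  have hstep : ∀ x, colorSetoid e S x (ρ x) := fun x =>
    colorSetoid_of_eq hc hc' (by simp [hρ])
  have hρe : ∀ x, e c' (ρ x) = e c x := fun x => by simp [hρ]
  have hoff : ∀ x, colorSetoid e S w x → x ≠ w → ρ x ≠ w → r x (ρ x) := by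
    intro x hx hxw hxw'
    refine colorSetoid_of_eq hc hc' ?_
    rw [contractLine_apply_of_ne hxw (fun h' => h c hc (h' ▸ hx)),
      contractLine_apply_of_ne hxw'
        (fun h' => h c' hc' (h' ▸ Setoid.trans' _ hx (hstep x))), hρe]
  -- Here `w` has a double edge, so both neighbours of `k` become joined to the same black vertex.
  by_cases hw : ρ w = w
  · refine colorSetoid_of_eq hc hc' ?_
    rw [contractLine_apply_symm, contractLine_apply_symm, ← hρe, hw]
  · have h1 : r (ρ w) (ρ.symm w) := by
      refine Equiv.Perm.rel_apply_symm_apply_of_rel_off hw fun x hx => hoff x ?_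
      exact Equiv.Perm.sameCycle_setoid_le (f := ρ) hstep hx
    have h2 : r ((e c).symm k) (ρ w) := by
      refine colorSetoid_of_eq hc hc' ?_
      rw [contractLine_apply_symm, contractLine_apply_of_ne hw
        (fun h' => h c' hc' (h' ▸ hstep w)), hρe]
    have h3 : r (ρ.symm w) ((e c').symm k) := by
      have hw' : ρ.symm w ≠ w := fun h' => hw (by rw [Equiv.symm_apply_eq] at h'; exact h'.symm)
      have h4 := hstep (ρ.symm w)
      rw [ρ.apply_symm_apply] at h4
      refine colorSetoid_of_eq hc hc' ?_
      rw [contractLine_apply_symm, contractLine_apply_of_ne hw'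
        (fun h' => h c hc (h' ▸ Setoid.symm' _ h4)), ← hρe, ρ.apply_symm_apply]
    exact Setoid.trans' _ h2 (Setoid.trans' _ h1 h3)

/-- Contracting a line between two components merges them and isolates the ends of the line. -/
theorem numComponents_contractLine [Finite W] (hS : S.Nonempty) {w : W} {k : K}
    (h : ∀ c ∈ S, ¬ colorSetoid e S w ((e c).symm k)) :
    numComponents (fun c => contractLine (e c) (w, k)) S = numComponents e S := by
  classical
  obtain ⟨c₀, h₀⟩ := hS
  set e' : ι → W ≃ K := fun c => contractLine (e c) (w, k) with he'
  set u : W := (e c₀).symm k with hu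
  have hiso : ∀ x y, colorSetoid e' S x y → (x = w ↔ y = w) := by
    intro x y hxy
    refine (colorSetoid_le (r := Setoid.comap (fun x => x = w) ⟨Iff, ⟨Iff.refl, Iff.symm, Iff.trans⟩⟩) ?_) hxy
    intro c hc c' hc' x y hx
    change x = w ↔ y = w
    have h1 : ∀ c x, e' c x = k ↔ x = w := fun c x => by
      rw [← contractLine_apply_left (e c) w k]
      exact (e' c).apply_eq_iff_eq
    rw [← h1 c, ← h1 c', hx]
  have hwu : w ≠ u := fun h' => h c₀ h₀ (by rw [← hu, ← h'])
  have h1 : ¬ colorSetoid e' S w u := fun h' => hwu.symm ((hiso w u h').1 rfl)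
  unfold numComponents
  rw [Setoid.card_quotient_eq_card_glue_add_one h1,
    Setoid.card_quotient_eq_card_glue_add_one (h c₀ h₀)]
  -- Before the contraction `w` and `u` lie in different components; afterwards `w` is isolated. In
  -- both graphs gluing them costs one class, so it suffices that the glued partitions agree.
  have key : (colorSetoid e' S).glue w u = (colorSetoid e S).glue w u := by
    have hnb : ∀ c ∈ S, colorSetoid e S ((e c).symm k) u := fun c hc =>
      colorSetoid_of_eq hc h₀ (by simp [hu])
    have hnb' : ∀ c ∈ S, colorSetoid e' S ((e c).symm k) u := fun c hc =>
      colorSetoid_contractLine_neighbours h hc h₀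
    have hsw : ∀ (r : Setoid W), (∀ c ∈ S, r ((e c).symm k) u) → ∀ c ∈ S, ∀ x,
        r.glue w u (Equiv.swap w ((e c).symm k) x) x := by
      intro r hr c hc x
      have h2 : r.glue w u w ((e c).symm k) :=
        Setoid.trans' _ Setoid.glue_pair (Setoid.symm' _ (Setoid.le_glue (hr c hc)))
      rw [Equiv.swap_apply_def]
      split_ifs with h3 h4
      · rw [h3]; exact Setoid.symm' _ h2
      · rw [h4]; exact h2
      · exact Setoid.refl' _ _
    have hee' : ∀ c x, e' c (Equiv.swap w ((e c).symm k) x) = e c x := fun c x => by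
      simp [he', contractLine_eq]
    have he'e : ∀ c x, e' c x = e c (Equiv.swap w ((e c).symm k) x) := fun c x => by
      simp [he', contractLine_eq]
    apply le_antisymm
    · refine Setoid.glue_le (colorSetoid_le ?_) Setoid.glue_pair
      intro c hc c' hc' x y hx
      rw [he'e, he'e] at hx
      exact Setoid.trans' _ (Setoid.symm' _ (hsw _ hnb c hc x)) (Setoid.trans' _
        (Setoid.le_glue (colorSetoid_of_eq hc hc' hx)) (hsw _ hnb c' hc' y))
    · refine Setoid.glue_le (colorSetoid_le ?_) Setoid.glue_pair
      intro c hc c' hc' x y hx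
      rw [← hee', ← hee'] at hx
      exact Setoid.trans' _ (Setoid.symm' _ (hsw _ hnb' c hc x)) (Setoid.trans' _
        (Setoid.le_glue (colorSetoid_of_eq hc hc' hx)) (hsw _ hnb' c' hc' y))
  rw [key]

/-! ## Trees of lines -/

/-- Cutting any of the lines disconnects its ends. -/
def AllBridges (e : ι → W ≃ K) (l : List (W × K)) : Prop :=
  ∀ p ∈ l, ¬ lineSetoid e Set.univ {q | q ∈ l ∧ q ≠ p} (Sum.inl p.1) (Sum.inr p.2)

theorem lineSetoid_mono {L L' : Set (W × K)} (h : L ⊆ L') : lineSetoid e S L ≤ lineSetoid e S L' :=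
  lineSetoid_le (fun _ hc w => lineSetoid_edge hc w) fun _ hp => lineSetoid_line (h hp)

/-- An edge created by the contraction is a path through the line `p`. -/
theorem lineSetoid_contractLine_le (p : W × K) (L : Set (W × K)) :
    lineSetoid (fun c => contractLine (e c) p) S L ≤ lineSetoid e S (insert p L) := by
  obtain ⟨w, k⟩ := p
  have hwk : lineSetoid e S (insert (w, k) L) (Sum.inl w) (Sum.inr k) :=
    lineSetoid_line (p := (w, k)) (Set.mem_insert _ _)
  refine lineSetoid_le (fun c hc x => ?_) fun p hp => lineSetoid_line (Set.mem_insert_of_mem _ hp)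
  by_cases h1 : x = w
  · rw [h1, contractLine_apply_left]
    exact hwk
  by_cases h2 : x = (e c).symm k
  · rw [h2, contractLine_apply_symm]
    refine Setoid.trans' _ (lineSetoid_edge hc _) ?_
    rw [Equiv.apply_symm_apply]
    exact Setoid.trans' _ (Setoid.symm' _ hwk) (lineSetoid_edge hc w)
  · rw [contractLine_apply_of_ne h1 h2]
    exact lineSetoid_edge hc x

theorem AllBridges.not_colorSetoid {p : W × K} {l : List (W × K)} (h : AllBridges e (p :: l))
    (c : ι) : ¬ colorSetoid e Set.univ p.1 ((e c).symm p.2) := by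
  intro h'
  refine h p List.mem_cons_self (Setoid.trans' _ (lineSetoid_inl_of_colorSetoid h') ?_)
  simpa using lineSetoid_edge (e := e) (L := {q | q ∈ p :: l ∧ q ≠ p}) (Set.mem_univ c)
    ((e c).symm p.2)

/-- A path avoiding `q` after the contraction lifts to one that uses `p` and still avoids `q`; hence
`p ∉ l`. -/
theorem AllBridges.contractLine {p : W × K} {l : List (W × K)} (h : AllBridges e (p :: l))
    (hp : p ∉ l) : AllBridges (fun c => contractLine (e c) p) l := by
  intro q hq h'
  refine h q (List.mem_cons_of_mem _ hq) (lineSetoid_mono ?_ (lineSetoid_contractLine_le _ _ h'))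
  rintro x (rfl | ⟨hx, hxq⟩)
  · exact ⟨List.mem_cons_self, fun h => hp (h ▸ hq)⟩
  · exact ⟨List.mem_cons_of_mem _ hx, hxq⟩

theorem AllBridges.numComponents_contractLines [Finite W] (hS : S.Nonempty) {l : List (W × K)}
    (hl : l.Nodup) (h : AllBridges e l) :
    numComponents (fun c => contractLines (e c) l) S = numComponents e S := by
  induction l generalizing e with
  | nil => rfl
  | cons p l ih =>
    rw [List.nodup_cons] at hl
    refine (ih hl.2 (h.contractLine hl.1)).trans ?_
    exact numComponents_contractLine hS fun c _ h' =>
      h.not_colorSetoid c (colorSetoid_mono (Set.subset_univ S) h')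

/-- No line joins, at the time of its contraction, two vertices already joined by an edge. -/
def ProperLines (e : W ≃ K) : List (W × K) → Prop
  | [] => True
  | p :: l => e p.1 ≠ p.2 ∧ ProperLines (contractLine e p) l

theorem AllBridges.properLines {l : List (W × K)} (hl : l.Nodup) (h : AllBridges e l) (c : ι) :
    ProperLines (e c) l := by
  induction l generalizing e with
  | nil => trivial
  | cons p l ih =>
    rw [List.nodup_cons] at hl
    refine ⟨fun h' => h.not_colorSetoid c ?_, ih hl.2 (h.contractLine hl.1)⟩
    rw [← h', Equiv.symm_apply_apply]

end

/-! ## Contraction of lines in a family of graphs -/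

section

variable {d : ℕ} {P : Type} {A A' : P → Type}

theorem sigmaCongrRight_update_contractLine [DecidableEq P] (g : ∀ p, A p ≃ A' p) (q : P)
    (x : A q × A' q) :
    Equiv.sigmaCongrRight (Function.update g q (contractLine (g q) x)) =
      contractLine (Equiv.sigmaCongrRight g) (⟨q, x.1⟩, ⟨q, x.2⟩) := by
  obtain ⟨w, k⟩ := x
  ext1 ⟨p, y⟩
  have hsymm : (Equiv.sigmaCongrRight g).symm ⟨q, k⟩ = ⟨q, (g q).symm k⟩ := rfl
  by_cases hp : p = q
  · subst hp
    rw [Equiv.sigmaCongrRight_apply]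
    simp only [Function.update_self]
    by_cases h1 : y = w
    · subst h1
      rw [contractLine_apply_left, contractLine_apply_left]
    by_cases h2 : y = (g p).symm k
    · subst h2
      rw [contractLine_apply_symm, ← hsymm, contractLine_apply_symm]
      rfl
    · rw [contractLine_apply_of_ne h1 h2, contractLine_apply_of_ne]
      · rfl
      · simpa using h1
      · rw [hsymm]; simpa using h2
  · rw [contractLine_apply_of_ne]
    · simp [Equiv.sigmaCongrRight, hp]
    · exact fun h => hp (congrArg Sigma.fst h)
    · rw [hsymm]
      exact fun h => hp (congrArg Sigma.fst h)

variable {σ : (Σ p, A p) ≃ (Σ p, A' p)}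

/-- The lines dropped in passing from `σ` to `τ` join a block to itself. -/
theorem blockSetoid_boundary {l : ∀ p, List (A p × A' p)}
    (hσ : ∀ p, ∀ x ∈ l p, σ ⟨p, x.1⟩ = ⟨p, x.2⟩)
    {τ : (Σ p, {w : A p // w ∉ (l p).map Prod.fst}) ≃ (Σ p, {k : A' p // k ∉ (l p).map Prod.snd})}
    (hτ : ∀ x, σ ⟨x.1, x.2.1⟩ = ⟨(τ x).1, (τ x).2.1⟩) : blockSetoid τ = blockSetoid σ := by
  apply le_antisymm
  · refine eqvGen_setoid_le ?_
    rintro _ _ ⟨x, rfl, rfl⟩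
    exact Relation.EqvGen.rel _ _ ⟨⟨x.1, x.2.1⟩, rfl, by rw [hτ]⟩
  · refine eqvGen_setoid_le ?_
    rintro p _ ⟨⟨_, w⟩, rfl, rfl⟩
    by_cases hw : w ∈ (l p).map Prod.fst
    · obtain ⟨⟨w', k⟩, hk, rfl⟩ := List.mem_map.1 hw
      rw [hσ p _ hk]
    · exact Relation.EqvGen.rel _ _ ⟨⟨p, ⟨w, hw⟩⟩, rfl, by rw [hτ ⟨p, ⟨w, hw⟩⟩]⟩

/-- A block whose vertices are joined by its edges and its lines stays connected when the lines
are replaced by edges of colour `0`. -/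
theorem colorSetoid_withZero_of_lineSetoid {e : ∀ p, Fin d → A p ≃ A' p} {p : P}
    {L : Set (A p × A' p)} (hσ : ∀ x ∈ L, σ ⟨p, x.1⟩ = ⟨p, x.2⟩) {w w' : A p}
    (h : lineSetoid (e p) Set.univ L (Sum.inl w) (Sum.inl w')) :
    colorSetoid (withZero e σ) Set.univ ⟨p, w⟩ ⟨p, w'⟩ := by
  refine (lineSetoid_le (r := (colorSetoid (withZero e σ) Set.univ).comap
    (Sum.elim (fun w : A p => ⟨p, w⟩) fun k : A' p => σ.symm ⟨p, k⟩)) ?_ ?_) h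
  · intro c _ w
    refine colorSetoid_of_eq (c := c.succ) (c' := 0) (Set.mem_univ _) (Set.mem_univ _) ?_
    simp [withZero]
  · intro x hx
    rw [Setoid.comap_rel]
    simp only [Sum.elim_inl, Sum.elim_inr]
    rw [← hσ x hx, Equiv.symm_apply_apply]

/-- Blocks can be replaced by isomorphic ones. -/
theorem zeroCycles_congr {D D' : P → Type} {e : ∀ p, Fin d → A p ≃ A' p}
    {e' : ∀ p, Fin d → D p ≃ D' p} (φ : ∀ p, A p ≃ D p) (ψ : ∀ p, A' p ≃ D' p)
    (h : ∀ p c w, ψ p (e p c w) = e' p c (φ p w)) (σ : (Σ p, A p) ≃ (Σ p, A' p)) :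
    zeroCycles e' ((Equiv.sigmaCongrRight φ).symm.trans (σ.trans (Equiv.sigmaCongrRight ψ))) =
      zeroCycles e σ := by
  refine Finset.sum_congr rfl fun c _ => ?_
  symm
  refine Equiv.Perm.numOrbits_conj _ _ (Equiv.sigmaCongrRight φ) ?_
  rintro ⟨p, w⟩
  simp only [Equiv.trans_apply, Equiv.symm_trans_apply, Equiv.symm_symm]
  congr 2
  rw [Equiv.eq_symm_apply]
  simp [h]

theorem blockSetoid_congr {D D' : P → Type} (φ : ∀ p, A p ≃ D p) (ψ : ∀ p, A' p ≃ D' p)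
    (σ : (Σ p, A p) ≃ (Σ p, A' p)) :
    blockSetoid ((Equiv.sigmaCongrRight φ).symm.trans (σ.trans (Equiv.sigmaCongrRight ψ))) =
      blockSetoid σ := by
  apply le_antisymm
  · refine eqvGen_setoid_le ?_
    rintro _ _ ⟨x, rfl, rfl⟩
    exact Relation.EqvGen.rel _ _ ⟨(Equiv.sigmaCongrRight φ).symm x, rfl, rfl⟩
  · refine eqvGen_setoid_le ?_
    rintro _ _ ⟨x, rfl, rfl⟩
    refine Relation.EqvGen.rel _ _ ⟨Equiv.sigmaCongrRight φ x, rfl, ?_⟩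
    rw [Equiv.trans_apply, Equiv.symm_apply_apply]
    rfl

variable [Finite P] [∀ p, Finite (A p)]

theorem numOrbits_update_contractLines [DecidableEq P] {q : P} {l : List (A q × A' q)}
    (hσ : ∀ x ∈ l, σ ⟨q, x.1⟩ = ⟨q, x.2⟩) (g : ∀ p, A p ≃ A' p) (hg : ProperLines (g q) l) :
    Equiv.Perm.numOrbits ((Equiv.sigmaCongrRight
        (Function.update g q (contractLines (g q) l))).trans σ.symm) =
      Equiv.Perm.numOrbits ((Equiv.sigmaCongrRight g).trans σ.symm) + l.length := by
  induction l generalizing g with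
  | nil => simp [contractLines]
  | cons x l ih =>
    have h1 := ih (fun y hy => hσ y (List.mem_cons_of_mem _ hy))
      (Function.update g q (contractLine (g q) x)) (by simpa using hg.2)
    simp only [Function.update_self, Function.update_idem] at h1
    refine h1.trans ?_
    rw [sigmaCongrRight_update_contractLine, numOrbits_contractLine (hσ x List.mem_cons_self),
      List.length_cons]
    · ring
    · intro h
      exact hg.1 (by simpa using h)

theorem numOrbits_sigma_contractLines {l : ∀ p, List (A p × A' p)}
    (hσ : ∀ p, ∀ x ∈ l p, σ ⟨p, x.1⟩ = ⟨p, x.2⟩) (g : ∀ p, A p ≃ A' p)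
    (hg : ∀ p, ProperLines (g p) (l p)) :
    Equiv.Perm.numOrbits ((Equiv.sigmaCongrRight fun p => contractLines (g p) (l p)).trans σ.symm) =
      Equiv.Perm.numOrbits ((Equiv.sigmaCongrRight g).trans σ.symm) + ∑ᶠ p, (l p).length := by
  classical
  have := Fintype.ofFinite P
  have key : ∀ s : Finset P, Equiv.Perm.numOrbits ((Equiv.sigmaCongrRight fun p =>
      if p ∈ s then contractLines (g p) (l p) else g p).trans σ.symm) =
      Equiv.Perm.numOrbits ((Equiv.sigmaCongrRight g).trans σ.symm) + ∑ p ∈ s, (l p).length := by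
    intro s
    induction s using Finset.induction_on with
    | empty => simp
    | insert q s hq ih =>
      rw [Finset.sum_insert hq]
      have h1 := numOrbits_update_contractLines (hσ q)
        (fun p => if p ∈ s then contractLines (g p) (l p) else g p) (by simpa [hq] using hg q)
      rw [ih] at h1
      have h2 : (fun p => if p ∈ insert q s then contractLines (g p) (l p) else g p) =
          Function.update (fun p => if p ∈ s then contractLines (g p) (l p) else g p) q
            (contractLines (if q ∈ s then contractLines (g q) (l q) else g q) (l q)) := by
        funext p
        by_cases hp : p = q
        · subst hp; simp [hq]
        · simp [hp]
      rw [h2, h1]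
      ring
  rw [finsum_eq_sum_of_fintype]
  simpa using key Finset.univ

theorem card_not_notMem_map_fst {W K : Type} {l : List (W × K)} (hl : (l.map Prod.fst).Nodup) :
    Nat.card {w // ¬ w ∉ l.map Prod.fst} = l.length := by
  classical
  have h1 : ∀ w, ¬ w ∉ l.map Prod.fst ↔ w ∈ (l.map Prod.fst).toFinset := by simp
  rw [Nat.card_congr (Equiv.subtypeEquivRight h1), Nat.card_eq_fintype_card, Fintype.card_coe,
    List.toFinset_card_of_nodup hl, List.length_map]

theorem Equiv.Perm.numOrbits_eq_subtype_add {W K : Type} [Finite W] {f σ : W ≃ K} {F : W → Prop}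
    {F' : K → Prop} (hf : ∀ x, F x ↔ F' (f x)) (hσ : ∀ x, F x ↔ F' (σ x))
    (h : ∀ x, ¬ F x → f x = σ x) :
    Equiv.Perm.numOrbits (f.trans σ.symm) =
      Equiv.Perm.numOrbits ((f.subtypeEquiv hf).trans (σ.subtypeEquiv hσ).symm) +
        Nat.card {x // ¬ F x} := by
  -- The two matchings are viewed as a graph with two colours, whose components are the orbits.
  have h1 := numComponents_eq_subtype_add (ι := Bool) (e := fun c => bif c then f else σ)
    (S := {false, true}) (P := F) (Q := F') (by rintro (_ | _) x; exacts [hσ x, hf x])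
    (by
      intro x hx c c'
      rcases c <;> rcases c' <;> simp [h x hx])
  rw [numComponents_pair, numComponents_pair] at h1
  exact h1

/-- Contracting lines of colour `0` which are bridges does not change the numbers of cycles. -/
theorem zeroCycles_boundary {e : ∀ p, Fin d → A p ≃ A' p} {l : ∀ p, List (A p × A' p)}
    (h1 : ∀ p, ((l p).map Prod.fst).Nodup) (h2 : ∀ p, ((l p).map Prod.snd).Nodup)
    (hσ : ∀ p, ∀ x ∈ l p, σ ⟨p, x.1⟩ = ⟨p, x.2⟩) (he : ∀ p c, ProperLines (e p c) (l p))
    {τ : (Σ p, {w : A p // w ∉ (l p).map Prod.fst}) ≃ (Σ p, {k : A' p // k ∉ (l p).map Prod.snd})}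
    (hτ : ∀ x, σ ⟨x.1, x.2.1⟩ = ⟨(τ x).1, (τ x).2.1⟩) :
    zeroCycles (fun p c => (contractLines (e p c) (l p)).subtypeEquiv
      (contractLines_free (l p) (e p c) (h1 p) (h2 p))) τ = zeroCycles e σ := by
  classical
  have := Fintype.ofFinite P
  refine Finset.sum_congr rfl fun c _ => ?_
  let f : (Σ p, A p) ≃ (Σ p, A' p) :=
    Equiv.sigmaCongrRight fun p => contractLines (e p c) (l p)
  -- Contraction creates one orbit per line, and deleting the ends of the lines, in `hsub`, removes
  -- as many.
  have hor := numOrbits_sigma_contractLines hσ (fun p => e p c) fun p => he p c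
  have hfF : ∀ x : Σ p, A p, x.2 ∉ (l x.1).map Prod.fst ↔ (f x).2 ∉ (l (f x).1).map Prod.snd :=
    fun x => contractLines_free (l x.1) (e x.1 c) (h1 x.1) (h2 x.1) x.2
  have hlines : ∀ x : Σ p, A p, ¬ x.2 ∉ (l x.1).map Prod.fst → f x = σ x := by
    rintro ⟨p, w⟩ hx
    rw [not_not] at hx
    obtain ⟨⟨w', k⟩, hk, hw⟩ := List.mem_map.1 hx
    cases hw
    rw [hσ p _ hk]
    exact congrArg (Sigma.mk p) (contractLines_of_mem (l p) (e p c) (h1 p) (h2 p) hk)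
  have hσF : ∀ x : Σ p, A p, x.2 ∉ (l x.1).map Prod.fst ↔ (σ x).2 ∉ (l (σ x).1).map Prod.snd := by
    intro x
    constructor
    · intro hx
      have := hτ ⟨x.1, ⟨x.2, hx⟩⟩
      rw [this]
      exact (τ ⟨x.1, ⟨x.2, hx⟩⟩).2.2
    · intro hx
      refine by_contra fun h : ¬ _ => ?_
      rw [← hlines x h, ← hfF x] at hx
      exact h hx
  have hsub := Equiv.Perm.numOrbits_eq_subtype_add (f := f) (σ := σ)
    (F := fun x => x.2 ∉ (l x.1).map Prod.fst) (F' := fun x => x.2 ∉ (l x.1).map Prod.snd)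
    hfF hσF hlines
  have hcard : Nat.card {x : Σ p, A p // ¬ x.2 ∉ (l x.1).map Prod.fst} =
      ∑ᶠ p, (l p).length := by
    rw [← Nat.card_congr (sigmaSubtype fun p (w : A p) => ¬ w ∉ (l p).map Prod.fst), Nat.card_sigma,
      finsum_eq_sum_of_fintype]
    exact Finset.sum_congr rfl fun p _ => card_not_notMem_map_fst (h1 p)
  rw [hcard, hor] at hsub
  rw [Nat.add_right_cancel hsub]
  refine Equiv.Perm.numOrbits_conj _ _ (sigmaSubtype fun p (w : A p) => w ∉ (l p).map Prod.fst) ?_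
  intro x
  generalize hy : ((Equiv.sigmaCongrRight fun p => (contractLines (e p c) (l p)).subtypeEquiv
      (contractLines_free (l p) (e p c) (h1 p) (h2 p))).trans τ.symm) x = y
  rw [Equiv.trans_apply, Equiv.symm_apply_eq] at hy
  rw [Equiv.trans_apply, Equiv.eq_symm_apply]
  apply Subtype.ext
  change σ ⟨y.1, y.2.1⟩ = f ⟨x.1, x.2.1⟩
  rw [hτ y, ← hy]
  rfl

end

/-! ## Trees of quartic bubbles -/

theorem ColoredGraph.withLines_reachable_iff {d : ℕ} (X : ColoredGraph (Fin d))
    (L : Set (X.W × X.K)) {a b : X.W ⊕ X.K} :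
    (X.withLines L).Reachable a b ↔ lineSetoid X.edge Set.univ L a b := by
  have h : X.withLines L = SimpleGraph.fromRel fun a b =>
      (∃ c ∈ Set.univ, ∃ w : X.W, a = Sum.inl w ∧ b = Sum.inr (X.edge c w)) ∨
        ∃ p ∈ L, a = Sum.inl p.1 ∧ b = Sum.inr p.2 := by
    ext a b
    simp only [ColoredGraph.withLines, ColoredGraph.colorSubgraph, SimpleGraph.sup_adj,
      SimpleGraph.fromRel_adj, ← and_or_left, or_or_or_comm]
  rw [h, SimpleGraph.fromRel_reachable_iff]
  rfl

/-- After contraction the two ends of each line are joined only to each other, so deleting them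
removes one component per line. -/
theorem Dashing.numComponents_boundary_add {d : ℕ} {X : ColoredGraph (Fin d)} (D : Dashing X)
    (S : Set (Fin d)) : numComponents D.boundary.edge S + D.lines.length =
      numComponents (fun c => contractLines (X.edge c) D.lines) S := by
  rw [numComponents_eq_subtype_add (e := fun c => contractLines (X.edge c) D.lines)
    (P := fun w => w ∉ D.lines.map Prod.fst) (Q := fun k => k ∉ D.lines.map Prod.snd)
    (fun c => contractLines_free D.lines (X.edge c) D.nodup_fst D.nodup_snd) ?_,
    card_not_notMem_map_fst D.nodup_fst]
  · rfl
  · intro x hx c c'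
    rw [not_not] at hx
    obtain ⟨⟨w, k⟩, hk, rfl⟩ := List.mem_map.1 hx
    rw [contractLines_of_mem _ _ D.nodup_fst D.nodup_snd hk,
      contractLines_of_mem _ _ D.nodup_fst D.nodup_snd hk]

namespace QuarticTree

variable {d : ℕ} (H : QuarticTree d)

theorem lines_nodup : H.dash.lines.Nodup := List.Nodup.of_map _ H.dash.nodup_fst

theorem lineSetoid_lines (a b : H.graph.W ⊕ H.graph.K) :
    lineSetoid H.graph.edge Set.univ {p | p ∈ H.dash.lines} a b :=
  (ColoredGraph.withLines_reachable_iff _ _).1 (H.connected.preconnected a b)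

/-- If the ends of `p` stayed joined without `p`, every path through `p` could be rerouted and
cutting `p` would not disconnect the graph. -/
theorem allBridges : AllBridges H.graph.edge H.dash.lines := by
  intro p hp h
  have := H.connected.nonempty
  refine H.isCut p hp ⟨fun a b => ?_⟩
  rw [ColoredGraph.withLines_reachable_iff]
  refine (lineSetoid_le (fun c hc w => lineSetoid_edge hc w) fun q hq => ?_) (H.lineSetoid_lines a b)
  by_cases hqp : q = p
  · rw [hqp]; exact h
  · exact lineSetoid_line (p := q) ⟨hq, hqp⟩

/-- The multiset of the colour sets of the quartic bubbles. -/
noncomputable def colorSets : Multiset (Finset (Fin d)) :=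
  (@Finset.univ H.I (Fintype.ofFinite H.I)).val.map H.colorSet

theorem numComponents_graph {S : Finset (Fin d)} (hS : S.Nonempty) :
    numComponents H.graph.edge (S : Set (Fin d)) =
      Nat.card H.I + H.colorSets.countP fun C => S ⊆ C ∨ Disjoint S C := by
  let := Fintype.ofFinite H.I
  have h1 : ∀ i, numComponents (ColoredGraph.quartic (H.colorSet i)).edge (S : Set (Fin d)) =
      1 + if S ⊆ H.colorSet i ∨ Disjoint S (H.colorSet i) then 1 else 0 := by
    intro i
    rw [(gmBuild_quartic (H.admissible i)).numComponents_eq hS, ← Multiset.cons_zero,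
      Multiset.countP_cons, Multiset.countP_zero, zero_add]
  refine (numComponents_sigma fun i => (ColoredGraph.quartic (H.colorSet i)).edge).trans ?_
  rw [finsum_eq_sum_of_fintype, Finset.sum_congr rfl fun i _ => h1 i, Finset.sum_add_distrib,
    Nat.card_eq_fintype_card, Finset.sum_const, smul_eq_mul, mul_one, Finset.card_univ,
    Finset.sum_boole, colorSets, Multiset.countP_map]
  rfl

/-- Contracting bridges preserves the number of components for every nonempty `S`, so `H` and `B`
have the same noncrossing counts up to a constant independent of `S`. -/
theorem colorSets_eq (hd : 0 < d) {B : ColoredGraph (Fin d)} {m : Multiset (Finset (Fin d))}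
    (h : GMBuild B m) (φ : H.boundary.Iso B) : H.colorSets = m := by
  have hadm : ∀ C ∈ H.colorSets, AdmissibleSet C := by
    intro C hC
    obtain ⟨i, -, rfl⟩ := Multiset.mem_map.1 hC
    exact H.admissible i
  have key : ∀ S : Finset (Fin d), S.Nonempty →
      1 + (m.countP fun C => S ⊆ C ∨ Disjoint S C) + H.dash.lines.length =
        Nat.card H.I + H.colorSets.countP fun C => S ⊆ C ∨ Disjoint S C := by
    intro S hS
    rw [← h.numComponents_eq hS, ← H.numComponents_graph hS,
      ← numComponents_congr φ.onW φ.onK fun c _ x => φ.comm c x]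
    exact (H.dash.numComponents_boundary_add _).trans
      (H.allBridges.numComponents_contractLines (Finset.coe_nonempty.2 hS) H.lines_nodup)
  have : NeZero d := ⟨hd.ne'⟩
  -- For all colours both counts vanish and the constant drops out: a tree has one more quartic
  -- bubble than lines.
  have h0 := key Finset.univ Finset.univ_nonempty
  rw [Multiset.countP_eq_zero.2 fun C hC => (h.admissible C hC).not_univ_subset hd,
    Multiset.countP_eq_zero.2 fun C hC => (hadm C hC).not_univ_subset hd] at h0
  refine eq_of_countP_noncrossing_eq hadm h.admissible fun S hS => ?_
  have := key S hS
  omega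

end QuarticTree

/-! ## Graphs built from trees of quartic bubbles -/

section

variable {d : ℕ} {R : Type} [Fintype R] {H : R → QuarticTree d} {B : R → ColoredGraph (Fin d)}
  {b : R → ℕ} {m : R → Multiset (Finset (Fin d))}

theorem TreeWick.zero_apply_free (G : TreeWick H b)
    (x : Σ p : (Σ r, Fin (b r)), (H p.1).dash.FreeW) :
    G.zero ⟨x.1, x.2.1⟩ = ⟨(G.contract x).1, (G.contract x).2.1⟩ := rfl

theorem TreeWick.totalCycles_boundaryMap (φ : ∀ r, (H r).boundary.Iso (B r)) (G : TreeWick H b) :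
    (boundaryMap φ G).graph.totalCycles = G.graph.totalCycles := by
  rw [Wick.totalCycles_eq]
  refine (zeroCycles_congr (P := Σ r, Fin (b r)) (e := fun p => (H p.1).boundary.edge)
    (e' := fun p => (B p.1).edge) (fun p => (φ p.1).onW) (fun p => (φ p.1).onK)
    (fun p => (φ p.1).comm) G.contract).trans ?_
  refine Eq.trans ?_ (Wick.totalCycles_eq G.zero).symm
  exact zeroCycles_boundary (P := Σ r, Fin (b r)) (l := fun p => (H p.1).dash.lines)
    (fun p => (H p.1).dash.nodup_fst) (fun p => (H p.1).dash.nodup_snd)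
    (fun p x hx => G.internal p x.1 x.2 hx)
    (fun p c => (H p.1).allBridges.properLines (H p.1).lines_nodup c) G.zero_apply_free

/-- Both sides reduce to the relation between blocks. A bubble `B r` is connected by its own edges,
a copy of `H r` by its edges together with its lines, which have become edges of colour 0. -/
theorem TreeWick.connected_boundaryMap_iff (hd : 0 < d) (hB : ∀ r, GMBuild (B r) (m r))
    (φ : ∀ r, (H r).boundary.Iso (B r)) (G : TreeWick H b) :
    (boundaryMap φ G).graph.Connected ↔ G.graph.Connected := by
  have h1 := connected_iff_blockSetoid (P := Σ r, Fin (b r)) (e := fun p => (B p.1).edge)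
    (σ := boundaryMap φ G) hd (fun p => ((hB p.1).connected hd).1)
    (fun p w w' => colorSetoid_withZero_of_block (((hB p.1).connected hd).2 w w'))
  have h2 := connected_iff_blockSetoid (P := Σ r, Fin (b r)) (e := fun p => (H p.1).graph.edge)
    (σ := G.zero) hd
    (fun p => let ⟨w⟩ := ((hB p.1).connected hd).1; ⟨((φ p.1).onW.symm w).1⟩)
    (fun p w w' => colorSetoid_withZero_of_lineSetoid (fun x hx => G.internal p x.1 x.2 hx)
      ((H p.1).lineSetoid_lines (Sum.inl w) (Sum.inl w')))
  have h3 : blockSetoid (boundaryMap φ G) = blockSetoid G.zero :=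
    (blockSetoid_congr (P := Σ r, Fin (b r)) (fun p => (φ p.1).onW) (fun p => (φ p.1).onK)
      G.contract).trans
    (blockSetoid_boundary (l := fun p : (Σ r, Fin (b r)) => (H p.1).dash.lines)
      (fun p x hx => G.internal p x.1 x.2 hx) G.zero_apply_free)
  rw [h3] at h1
  exact (Wick.connected_iff _).trans (h1.trans (h2.symm.trans (Wick.connected_iff G.zero).symm))

/-- Every matching of the vertices of the boundary bubbles comes from a matching containing the
internal lines of the trees. -/
theorem TreeWick.exists_contract_eq (hd : 0 < d)
    (τ : (Σ p : (Σ r, Fin (b r)), (H p.1).dash.FreeW) ≃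
      (Σ p : (Σ r, Fin (b r)), (H p.1).dash.FreeK)) :
    ∃ G : TreeWick H b, G.contract = τ := by
  classical
  let F : (Σ p : (Σ r, Fin (b r)), (H p.1).graph.W) → Prop :=
    fun x => x.2 ∉ (H x.1.1).dash.lines.map Prod.fst
  let F' : (Σ p : (Σ r, Fin (b r)), (H p.1).graph.K) → Prop :=
    fun x => x.2 ∉ (H x.1.1).dash.lines.map Prod.snd
  -- Any matching containing the internal lines would do; contracting them in the first colour
  -- provides one. It is used at the ends of lines, and `τ` elsewhere.
  let E : (Σ p : (Σ r, Fin (b r)), (H p.1).graph.W) ≃ (Σ p : (Σ r, Fin (b r)), (H p.1).graph.K) :=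
    Equiv.sigmaCongrRight fun p => contractLines ((H p.1).graph.edge ⟨0, hd⟩) (H p.1).dash.lines
  have hE : ∀ x, ¬ F x ↔ ¬ F' (E x) := fun x => not_congr
    (contractLines_free _ _ (H x.1.1).dash.nodup_fst (H x.1.1).dash.nodup_snd x.2)
  let τ' : {x // F x} ≃ {x // F' x} :=
    (sigmaSubtype fun (p : Σ r, Fin (b r)) (w : (H p.1).graph.W) =>
      w ∉ (H p.1).dash.lines.map Prod.fst).symm.trans (τ.trans
        (sigmaSubtype fun (p : Σ r, Fin (b r)) (k : (H p.1).graph.K) =>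
          k ∉ (H p.1).dash.lines.map Prod.snd))
  let ζ := (Equiv.sumCompl F).symm.trans
    ((Equiv.sumCongr τ' (E.subtypeEquiv hE)).trans (Equiv.sumCompl F'))
  have hfree : ∀ x (hx : F x), ζ x = (τ' ⟨x, hx⟩).1 := by
    intro x hx
    simp [ζ, Equiv.sumCompl_symm_apply_of_pos hx]
  have hlines : ∀ x (hx : ¬ F x), ζ x = E x := by
    intro x hx
    simp [ζ, Equiv.sumCompl_symm_apply_of_neg hx]
  refine ⟨⟨ζ, ?_⟩, ?_⟩
  · intro p w k h
    refine (hlines ⟨p, w⟩ (not_not.2 (List.mem_map.2 ⟨_, h, rfl⟩))).trans ?_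
    exact congrArg (Sigma.mk p)
      (contractLines_of_mem _ _ (H p.1).dash.nodup_fst (H p.1).dash.nodup_snd h)
  · refine Equiv.ext fun x => ?_
    have h1 := hfree ⟨x.1, x.2.1⟩ x.2.2
    refine (sigmaSubtype fun (p : Σ r, Fin (b r)) (k : (H p.1).graph.K) =>
      k ∉ (H p.1).dash.lines.map Prod.snd).injective (Subtype.ext ?_)
    exact h1

theorem Equiv.symm_trans_conj_trans {α β γ δ : Type*} (f : α ≃ β) (g : γ ≃ δ) (t : β ≃ δ) :
    f.symm.trans ((f.trans (t.trans g.symm)).trans g) = t := by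
  ext x
  simp

theorem boundaryMap_surjective (hd : 0 < d) (φ : ∀ r, (H r).boundary.Iso (B r)) :
    Function.Surjective (boundaryMap φ (b := b)) := by
  intro τ
  obtain ⟨G, hG⟩ := TreeWick.exists_contract_eq (H := H) (b := b) hd
    ((Equiv.sigmaCongrRight fun p : (Σ r, Fin (b r)) => (φ p.1).onW).trans
      (Equiv.trans τ (Equiv.sigmaCongrRight fun p : (Σ r, Fin (b r)) => (φ p.1).onK).symm))
  refine ⟨G, ?_⟩
  unfold boundaryMap
  rw [hG]
  exact Equiv.symm_trans_conj_trans _ _ _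

theorem boundaryMap_mem_maxGraphs_iff (hd : 0 < d) (hB : ∀ r, GMBuild (B r) (m r))
    (φ : ∀ r, (H r).boundary.Iso (B r)) (G : TreeWick H b) :
    boundaryMap φ G ∈ maxGraphs B b ↔
      G ∈ maxTreeGraphs H (fun r => scalingCoefficient (B r) (m r)) b := by
  rw [mem_maxGraphs_iff hd hB]
  refine and_congr (G.connected_boundaryMap_iff hd hB φ) ?_
  rw [amplitudeDegree, amplitudeDegree, G.totalCycles_boundaryMap φ]

theorem maxGraphs_eq_image (hd : 0 < d) (hB : ∀ r, GMBuild (B r) (m r))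
    (φ : ∀ r, (H r).boundary.Iso (B r)) (b : R → ℕ) :
    maxGraphs B b =
      boundaryMap φ '' maxTreeGraphs H (fun r => scalingCoefficient (B r) (m r)) b := by
  ext σ
  constructor
  · intro hσ
    obtain ⟨G, rfl⟩ := boundaryMap_surjective hd φ σ
    exact ⟨G, (boundaryMap_mem_maxGraphs_iff hd hB φ G).1 hσ, rfl⟩
  · rintro ⟨G, hG, rfl⟩
    exact (boundaryMap_mem_maxGraphs_iff hd hB φ G).2 hG

end

/-! ## Dominant graphs of the quartic model -/

namespace ColoredGraph

variable {ι : Type} {X Y : ColoredGraph ι}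

theorem Iso.connected_iff [Nonempty ι] (φ : X.Iso Y) : X.Connected ↔ Y.Connected := by
  have h : ∀ x y, colorSetoid X.edge Set.univ x y ↔
      colorSetoid Y.edge Set.univ (φ.onW x) (φ.onW y) :=
    colorSetoid_congr φ.onW φ.onK fun c _ x => φ.comm c x
  rw [ColoredGraph.connected_iff, ColoredGraph.connected_iff, φ.onW.nonempty_congr]
  refine and_congr_right fun _ => ⟨fun hX x y => ?_, fun hY x y => (h x y).2 (hY _ _)⟩
  have := (h (φ.onW.symm x) (φ.onW.symm y)).1 (hX _ _)
  rwa [φ.onW.apply_symm_apply, φ.onW.apply_symm_apply] at this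

theorem Iso.totalCycles_eq {d : ℕ} {X Y : ColoredGraph (Fin (d + 1))} (φ : X.Iso Y) :
    X.totalCycles = Y.totalCycles := by
  refine Finset.sum_congr rfl fun c _ => ?_
  unfold numCycles
  rw [card_connectedComponent X ⟨0, by simp⟩, card_connectedComponent Y ⟨0, by simp⟩]
  exact numComponents_congr φ.onW φ.onK fun c _ x => φ.comm c x

end ColoredGraph

theorem exists_equiv_sigma_fin {α β : Type} [Finite α] (f : α → β) {n : β → ℕ}
    (hn : ∀ y, Nat.card {x // f x = y} = n y) :
    ∃ ε : α ≃ Σ y, Fin (n y), ∀ x, (ε x).1 = f x :=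
  ⟨(Equiv.sigmaFiberEquiv f).symm.trans
    (Equiv.sigmaCongrRight fun y => Finite.equivFinOfCardEq (hn y)), fun _ => rfl⟩

section

variable {d : ℕ} {R : Type} [Fintype R] {H : R → QuarticTree d} {B : R → ColoredGraph (Fin d)}
  {b : R → ℕ} {m : R → Multiset (Finset (Fin d))}

theorem QuarticTree.card_fiber (H : QuarticTree d) (C : Finset (Fin d)) :
    Nat.card {i // H.colorSet i = C} = H.colorSets.count C := by
  classical
  let := Fintype.ofFinite H.I
  rw [Nat.card_eq_fintype_card, Fintype.card_subtype, colorSets, Multiset.count_map]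
  simp only [eq_comm]
  rfl

/-- Both sums depend only on the total multiset of colour sets, which is the same for the bubbles `B
r` and for the quartic bubbles. -/
theorem sum_scalingCoefficient_quarticFamily (hB : ∀ r, GMBuild (B r) (m r)) :
    ∑ C : {C : Finset (Fin d) // AdmissibleSet C},
        scalingCoefficient (quarticFamily d C) {C.1} * ((∑ r, (m r).count C.1 * b r : ℕ) : ℝ) =
      ∑ r, scalingCoefficient (B r) (m r) * (b r : ℝ) := by
  classical
  have h := sum_scalingCoefficient (B := quarticFamily d) (m := fun C => {C.1})
    (b := fun C => ∑ r, (m r).count C.1 * b r) fun C => gmBuild_quartic C.2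
  rw [h, sum_scalingCoefficient hB, finsum_copies m,
    finsum_copies fun C : {C : Finset (Fin d) // AdmissibleSet C} => {C.1}]
  have hmul : ∑ C : {C : Finset (Fin d) // AdmissibleSet C},
      (∑ r, (m r).count C.1 * b r) • ({C.1} : Multiset (Finset (Fin d))) = ∑ r, b r • m r := by
    ext A
    simp only [Multiset.count_sum', Multiset.count_nsmul, Multiset.count_singleton]
    by_cases hA : AdmissibleSet A
    · rw [Finset.sum_eq_single ⟨A, hA⟩]
      · simp [mul_comm]
      · rintro C - hC
        rw [if_neg fun h => hC (Subtype.ext h.symm), mul_zero]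
      · simp
    · rw [Finset.sum_eq_zero, Finset.sum_eq_zero]
      · intro r _
        rw [Multiset.count_eq_zero.2 fun h => hA ((hB r).admissible A h), mul_zero]
      · rintro C -
        rw [if_neg fun h : A = C.1 => hA (h ▸ C.2), mul_zero]
  rw [hmul]

/-- The quartic bubbles of all copies of the `H r` are regrouped by colour set. By
`QuarticTree.colorSets_eq` their numbers are those prescribed by the `m r`. -/
theorem TreeWick.exists_quartic_iso (hd : 0 < d) (hB : ∀ r, GMBuild (B r) (m r))
    (φ : ∀ r, (H r).boundary.Iso (B r)) (G : TreeWick H b) :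
    ∃ τ : Wick (quarticFamily d) (fun C => ∑ r, (m r).count C.1 * b r),
      Nonempty (G.graph.Iso τ.graph) := by
  classical
  let f : (Σ p : (Σ r, Fin (b r)), (H p.1).I) → {C : Finset (Fin d) // AdmissibleSet C} :=
    fun x => ⟨(H x.1.1).colorSet x.2, (H x.1.1).admissible x.2⟩
  have hf : ∀ C, Nat.card {x // f x = C} = ∑ r, (m r).count C.1 * b r := by
    intro C
    have h1 : ∀ x, f x = C ↔ (H x.1.1).colorSet x.2 = C.1 := fun x => Subtype.ext_iff
    rw [Nat.card_congr (Equiv.subtypeEquivRight h1),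
      ← Nat.card_congr (sigmaSubtype fun (p : Σ r, Fin (b r)) i => (H p.1).colorSet i = C.1),
      Nat.card_sigma, Fintype.sum_sigma]
    refine Finset.sum_congr rfl fun r _ => ?_
    simp only [QuarticTree.card_fiber, (H r).colorSets_eq hd (hB r) (φ r)]
    simp [mul_comm]
  obtain ⟨ε, hε⟩ := exists_equiv_sigma_fin f hf
  let η : (Σ p : (Σ r, Fin (b r)), Σ _ : (H p.1).I, Fin 2) ≃
      Σ _ : (Σ C : {C : Finset (Fin d) // AdmissibleSet C}, Fin (∑ r, (m r).count C.1 * b r)),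
        Fin 2 :=
    (Equiv.sigmaAssoc fun (p : Σ r, Fin (b r)) (_ : (H p.1).I) => Fin 2).symm.trans
      (Equiv.sigmaCongrLeft (β := fun _ => Fin 2) ε)
  refine ⟨η.symm.trans (Equiv.trans G.zero η), ⟨⟨η, η, fun c => ?_⟩⟩⟩
  refine Fin.cases ?_ (fun c => ?_) c
  · intro w
    change η (G.zero w) = η (G.zero (η.symm (η w)))
    exact congrArg (fun v => η (G.zero v)) (η.symm_apply_apply w).symm
  · rintro ⟨p, i, a⟩
    change (⟨ε ⟨p, i⟩, (ColoredGraph.quartic ((H p.1).colorSet i)).edge c a⟩ : Σ _, Fin 2) =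
      ⟨ε ⟨p, i⟩, (ColoredGraph.quartic (ε ⟨p, i⟩).1.1).edge c a⟩
    rw [hε]

theorem exists_mem_maxGraphs_quarticFamily (hd : 0 < d) (hB : ∀ r, GMBuild (B r) (m r))
    (φ : ∀ r, (H r).boundary.Iso (B r)) {G : TreeWick H b}
    (hG : G ∈ maxTreeGraphs H (fun r => scalingCoefficient (B r) (m r)) b) :
    ∃ τ ∈ maxGraphs (quarticFamily d) (fun C => ∑ r, (m r).count C.1 * b r),
      Nonempty (G.graph.Iso τ.graph) := by
  obtain ⟨τ, ⟨ψ⟩⟩ := G.exists_quartic_iso hd hB φ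
  refine ⟨τ, (mem_maxGraphs_iff (B := quarticFamily d) (m := fun C => {C.1}) hd
    fun C => gmBuild_quartic C.2).2 ⟨ψ.connected_iff.1 hG.1, ?_⟩, ⟨ψ⟩⟩
  have h1 : (G.graph.totalCycles : ℝ) + _ = d := hG.2
  rw [ψ.totalCycles_eq, ← sum_scalingCoefficient_quarticFamily hB] at h1
  exact h1

end

theorem theorem2 {d : ℕ} (hd : 3 ≤ d) {R : Type} [Fintype R]
    (B : R → ColoredGraph (Fin d)) (m : R → Multiset (Finset (Fin d)))
    (hB : ∀ r, GMBuild (B r) (m r)) :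
    -- uniqueness of the scaling with a non-trivial large-N limit
    (∀ s : R → ℝ, HasNontrivialLargeNLimit B s ↔ ∀ r, s r = scalingCoefficient (B r) (m r)) ∧
    -- lower bound on the scaling coefficients, attained by melonic bubbles only
    (∀ r, (IsMelonic (B r) →
        scalingCoefficient (B r) (m r) = -((d : ℝ) - 1) * ((B r).numVertices - 2) / 2) ∧
      (¬ IsMelonic (B r) →
        scalingCoefficient (B r) (m r) > -((d : ℝ) - 1) * ((B r).numVertices - 2) / 2)) ∧
    -- dominant graphs: leading order is reached for all numbers of bubbles
    (∀ b : R → ℕ,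
      leadingGraphs B (fun r => scalingCoefficient (B r) (m r)) b = maxGraphs B b) ∧
    -- dominant graphs come from dominant graphs of the quartic model
    (∀ (H : R → QuarticTree d) (φ : ∀ r, (H r).boundary.Iso (B r)) (b : R → ℕ),
      maxGraphs B b =
        boundaryMap φ '' maxTreeGraphs H (fun r => scalingCoefficient (B r) (m r)) b ∧
      ∀ G ∈ maxTreeGraphs H (fun r => scalingCoefficient (B r) (m r)) b,
        ∃ τ ∈ maxGraphs (quarticFamily d) (fun C => ∑ r, (m r).count C.1 * b r),
          Nonempty (G.graph.Iso τ.graph)) := by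
  have hd' : 0 < d := by omega
  refine ⟨hasNontrivialLargeNLimit_iff hd' hB, fun r => ⟨?_, ?_⟩,
    leadingGraphs_eq_maxGraphs hd' hB, fun H φ b => ⟨maxGraphs_eq_image hd' hB φ b, ?_⟩⟩
  · exact IsMelonic.scalingCoefficient_eq hd (hB r)
  · exact scalingCoefficient_gt_of_not_isMelonic (hB r)
  · exact fun G hG => exists_mem_maxGraphs_quarticFamily hd' hB φ hG
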